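/- **Conventions.** For a function $f$ holomorphic near $\zeta\in\mathbb C$ with Taylor series $\sum_{v\ge 0} a_v(z-\zeta)^v$ and $p,q\in\mathbb N=\{0,1,2,\dots\}$, the Padé approximant $[p/q]_{f,\zeta}$ is the rational function $A/B$, where $A,B$ are polynomials with $\deg A\le p$, $\deg B\le q$, $B(\zeta)=1$, whose Taylor expansion at $\zeta$ has the coefficients $a_0,\dots,a_{p+q}$ in the orders $0,\dots,p+q$; it is unique if it exists. We write $f\in\mathfrak D_{p,q}(\zeta)$ if the $q\times q$ Hankel determinant $\det(a_{p-q+1+i+j})_{0\le i,j<q}$ is non-zero, where $a_k=0$ for $k<0$ and the empty determinant is $1$; then $[p/q]_{f,\zeta}$ exists. In the suprema below, $|[p/q]_{f,\zeta}(z)-w|=+\infty$ if $z$ is a pole of $[p/q]_{f,\zeta}$, and a supremum over the empty set is $0$. $\mathcal H(\Omega)$ is the space of holomorphic functions on $\Omega$ with the topology of uniform convergence on compact sets. **Theorem 3.4.** Let $\mathfrak F\subset\mathbb N\times\mathbb N$ contain a sequence $(\tilde p_n,\tilde q_n)$ with $\tilde p_n\to+\infty$, and let $\Omega\subset\mathbb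 C$ be a simply connected domain. Let $\mathcal U$ be the set of all $f\in\mathcal H(\Omega)$ with the following property: for every compact set $K\subset\mathbb C\setminus\Omega$ with connected complement and every polynomial $h$ there is a sequence $(p_n,q_n)\in\mathfrak F$, $n=1,2,\dots$, such that for every compact set $L\subset\Omega$ 1. there is $n_0=n_0(L)$ such that $f\in\mathfrak D_{p_n,q_n}(\zeta)$ for all $n\ge n_0$ and all $\zeta\in L$ (so that $[p_n/q_n]_{f,\zeta}$ exists); 2. $\sup_{\zeta\in L,\,z\in K}\bigl|[p_n/q_n]_{f,\zeta}(z)-h(z)\bigr|\to 0$ as $n\to\infty$; 3. $\sup_{\zeta\in L,\,z\in L}\bigl|[p_n/q_n]_{f,\zeta}(z)-f(z)\bigr|\to 0$ as $n\to\infty$. (The finitely many terms with $n<n_0(L)$ are disregarded in 2 and 3.) Then $\mathcal U$ is non-empty, and it is a dense $G_\delta$ subset of $\mathcal H(\Omega)$. -/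

import Mathlib

open Filter Topology Polynomial

open scoped ENNReal PowerSeries

noncomputable section

namespace UniversalPade

/-- The extension by zero to `ℂ` of a function on `Ω`. -/
def extendZero {Ω : Set ℂ} (g : C(Ω, ℂ)) : ℂ → ℂ :=
  Function.extend Subtype.val (fun z : Ω => g z) 0

/-- The space `H(Ω)` of holomorphic functions on (an open set) `Ω`. As a subtype of `C(Ω, ℂ)` it
carries the compact-open topology, which is the topology of uniform convergence on compacta. -/
abbrev Hol (Ω : Set ℂ) : Type :=
  {g : C(Ω, ℂ) // DifferentiableOn ℂ (extendZero g) Ω}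

/-- A member of `H(Ω)` as a function on `ℂ`; only its values on `Ω` are used. -/
def Hol.toFun {Ω : Set ℂ} (f : Hol Ω) : ℂ → ℂ :=
  extendZero f.1

/-- The Taylor series `∑ a_v (z - ζ)^v` of `F` with centre `ζ`, as the formal power series with
coefficients `a_v = F^(v)(ζ) / v!`. -/
def taylorSeries (F : ℂ → ℂ) (ζ : ℂ) : ℂ⟦X⟧ :=
  PowerSeries.mk fun v => iteratedDeriv v F ζ / (Nat.factorial v : ℂ)

/-- The `q × q` Hankel matrix of the power series `a`, with entries `a_{p-q+1+i+j}`
for `0 ≤ i, j < q`, where `a_k = 0` for `k < 0`. -/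
def hankel (a : ℂ⟦X⟧) (p q : ℕ) : Matrix (Fin q) (Fin q) ℂ :=
  Matrix.of fun i j =>
    if p + 1 + i + j < q then 0 else PowerSeries.coeff (p + 1 + i + j - q) a

/-- `f ∈ 𝔇_{p,q}(ζ)`, where `a` is the power series of `f` with centre `ζ`. For `q = 0` the
determinant is empty, hence equal to `1`. -/
def InD (a : ℂ⟦X⟧) (p q : ℕ) : Prop :=
  (hankel a p q).det ≠ 0

/-- The rational function `Φ` is a `[p/q]` Padé approximant of the power series
`∑ a_v (z - ζ)^v`: `Φ = A / B` with `deg A ≤ p`, `deg B ≤ q`, `B(ζ) = 1`, and the expansion of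
`A / B` in powers of `z - ζ` agrees with `a` up to order `p + q`. Here `taylor ζ A` is `A` written
in powers of `z - ζ`. -/
def IsPade (a : ℂ⟦X⟧) (ζ : ℂ) (p q : ℕ) (Φ : RatFunc ℂ) : Prop :=
  ∃ A B : ℂ[X], A.natDegree ≤ p ∧ B.natDegree ≤ q ∧ B.eval ζ = 1 ∧
    Φ = algebraMap ℂ[X] (RatFunc ℂ) A / algebraMap ℂ[X] (RatFunc ℂ) B ∧
    ∀ v ≤ p + q,
      PowerSeries.coeff v ((taylor ζ A : ℂ⟦X⟧) * (taylor ζ B : ℂ⟦X⟧)⁻¹) = PowerSeries.coeff v a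

open Classical in
/-- The Padé approximant `[p/q]` of `∑ a_v (z - ζ)^v` (unique as a rational function when it
exists; the value `0` otherwise is never relevant). -/
def pade (a : ℂ⟦X⟧) (ζ : ℂ) (p q : ℕ) : RatFunc ℂ :=
  if h : ∃ Φ, IsPade a ζ p q Φ then h.choose else 0

open Classical in
/-- `|Φ(z) - w|` for a rational function `Φ` and `w ∈ ℂ`, equal to `∞` if `z` is a pole of `Φ`. -/
def ratDist (Φ : RatFunc ℂ) (z w : ℂ) : ℝ≥0∞ :=
  if Φ.denom.eval z = 0 then ⊤ else ‖Φ.eval (RingHom.id ℂ) z - w‖ₑ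

/-- `sup_{ζ ∈ L, z ∈ S} |[p/q]_{F,ζ}(z) - w(z)|`. -/
def padeError (F : ℂ → ℂ) (L S : Set ℂ) (p q : ℕ) (w : ℂ → ℂ) : ℝ≥0∞ :=
  ⨆ ζ ∈ L, ⨆ z ∈ S, ratDist (pade (taylorSeries F ζ) ζ p q) z (w z)

/-- The set of universal functions: those `f ∈ H(Ω)` such that for every compact `K ⊆ ℂ \ Ω` with
connected complement and every polynomial `h` there is one sequence in `𝔉` along which, for every
compact `L ⊆ Ω`, from some index on `f ∈ 𝔇_{p_n,q_n}(ζ)` (and the Padé approximant exists) for all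
`ζ ∈ L`, and the approximants with centres `ζ ∈ L` converge to `h` on `K` and to `f` on `L`,
uniformly in `ζ` and `z`. -/
def universalSet (𝔉 : Set (ℕ × ℕ)) (Ω : Set ℂ) : Set (Hol Ω) :=
  {f | ∀ K : Set ℂ, IsCompact K → K ⊆ Ωᶜ → IsConnected Kᶜ → ∀ h : ℂ[X],
    ∃ p q : ℕ → ℕ, (∀ n, (p n, q n) ∈ 𝔉) ∧
      ∀ L : Set ℂ, IsCompact L → L ⊆ Ω →
        (∀ᶠ n in atTop, ∀ ζ ∈ L,
          InD (taylorSeries f.toFun ζ) (p n) (q n) ∧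
            ∃ Φ, IsPade (taylorSeries f.toFun ζ) ζ (p n) (q n) Φ) ∧
        Tendsto (fun n => padeError f.toFun L K (p n) (q n) fun z => h.eval z) atTop (𝓝 0) ∧
        Tendsto (fun n => padeError f.toFun L L (p n) (q n) f.toFun) atTop (𝓝 0)}

end UniversalPade

end

/-! The proof is a Baire category argument in `Hol Ω`. The universal functions form a countable
intersection of sets `goodSet`, in each of which a single pair from 𝔉 does the job for fixed K, L,
polynomial and tolerance (`universalSet_eq_iInter`). Countability comes from a cofinal sequence of
admissible K, a sequence of polynomials dense on each of them, and an exhaustion of Ω.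

Each `goodSet` is open: where the Hankel determinant is non-zero, numerator and denominator solve a
linear system and depend continuously on function and centre, and compactness of K and L makes this
uniform.

Each is dense: approximate f on a compact subset of Ω and h on K by one polynomial P, then add a
small multiple of z^p with (p, q) ∈ 𝔉 and p > deg P. A polynomial of exact degree p lies in 𝔇_{p,q}
at every centre and is its own [p/q] approximant, whatever q is. Hence only p_n → ∞ matters.

The simultaneous approximation is Runge's theorem on a disjoint union of compact sets, whose
complement must have no bounded component. This is tested by logarithms: if z - a has a holomorphic
logarithm near S, then a lies in no bounded component of the complement of S, and such logarithms
glue over disjoint compact sets. Runge's theorem itself combines the Cauchy–Pompeiu formula with the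
spectrum of z in the closed algebra generated by polynomials. -/

noncomputable section

/-! ### Cutoff functions and the Cauchy–Pompeiu formula -/

namespace UniversalPade

open MeasureTheory Complex

/-- The Cauchy–Riemann operator `2i ∂/∂z̄`. -/
def dbar (g : ℂ → ℂ) (w : ℂ) : ℂ := I * fderiv ℝ g w 1 - fderiv ℝ g w I

theorem exists_contDiff_cutoff {Z N : Set ℂ} (hZ : IsCompact Z) (hN : IsOpen N) (h : Z ⊆ N) :
    ∃ χ : ℂ → ℂ, ContDiff ℝ 2 χ ∧ HasCompactSupport χ ∧ tsupport χ ⊆ N ∧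
      ∀ z ∈ Z, ∀ᶠ w in 𝓝 z, χ w = 1 := by
  obtain ⟨Z₁, hZ₁, hZZ₁, hZ₁N⟩ := exists_compact_between hZ hN h
  obtain ⟨Z₂, hZ₂, hZ₁Z₂, hZ₂N⟩ := exists_compact_between hZ₁ hN hZ₁N
  obtain ⟨f, hf, -, hs, h1⟩ := exists_contMDiff_support_eq_eq_one_iff (n := 2)
    (modelWithCornersSelf ℝ ℂ) isOpen_interior hZ₁.isClosed hZ₁Z₂
  have hsupp : Function.support (fun z => (f z : ℂ)) = interior Z₂ := by
    rw [← hs]; ext; simp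
  have hts : tsupport (fun z => (f z : ℂ)) ⊆ Z₂ := by
    rw [tsupport, hsupp]
    exact closure_minimal interior_subset hZ₂.isClosed
  refine ⟨fun z => (f z : ℂ), ?_, hZ₂.of_isClosed_subset (isClosed_tsupport _) hts,
    hts.trans hZ₂N, fun z hz => ?_⟩
  · exact ofRealCLM.contDiff.comp hf.contDiff
  · filter_upwards [isOpen_interior.mem_nhds (hZZ₁ hz)] with w hw
    simp [(h1 w).1 (interior_subset hw)]

theorem dbar_eq_zero {g : ℂ → ℂ} {w : ℂ} (h : DifferentiableAt ℂ g w) : dbar g w = 0 := by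
  have := h.fderiv_restrictScalars ℝ
  simp only [dbar, this, ContinuousLinearMap.coe_restrictScalars']
  have h2 : fderiv ℂ g w I = I * fderiv ℂ g w 1 := by
    simp
  rw [h2, sub_self]

theorem dbar_mul {f g : ℂ → ℂ} {w : ℂ} (hf : DifferentiableAt ℂ f w)
    (hg : DifferentiableAt ℝ g w) : dbar (fun z => g z * f z) w = dbar g w * f w := by
  have h0 := dbar_eq_zero hf
  simp only [dbar] at h0 ⊢
  rw [fderiv_fun_mul hg (hf.restrictScalars ℝ)]
  simp only [add_apply, smul_apply, smul_eq_mul]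
  linear_combination g w * h0

theorem dbar_congr {f g : ℂ → ℂ} {w : ℂ} (h : f =ᶠ[𝓝 w] g) : dbar f w = dbar g w := by
  simp only [dbar, h.fderiv_eq]

theorem continuous_dbar {g : ℂ → ℂ} (hg : ContDiff ℝ 1 g) : Continuous (dbar g) := by
  have h := hg.continuous_fderiv one_ne_zero
  unfold dbar
  fun_prop

theorem dbar_eq_zero_of_notMem_tsupport {g : ℂ → ℂ} {w : ℂ} (hw : w ∉ tsupport g) :
    dbar g w = 0 := by
  have : fderiv ℝ g w = 0 := by
    by_contra h
    exact hw (support_fderiv_subset ℝ h)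
  simp [dbar, this]

theorem hasCompactSupport_dbar {g : ℂ → ℂ} (hg : HasCompactSupport g) :
    HasCompactSupport (dbar g) :=
  hg.mono' fun _ hw => by
    by_contra h
    exact hw (dbar_eq_zero_of_notMem_tsupport h)

theorem continuous_dbar_div {g : ℂ → ℂ} (hg : ContDiff ℝ 1 g) {z : ℂ}
    (hz : ∀ᶠ w in 𝓝 z, DifferentiableAt ℂ g w) : Continuous fun w => dbar g w / (w - z) := by
  rw [continuous_iff_continuousAt]
  intro w
  rcases eq_or_ne w z with rfl | hw
  · refine (continuousAt_const (y := (0 : ℂ))).congr ?_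
    filter_upwards [hz] with v hv
    simp [dbar_eq_zero hv]
  · exact (continuous_dbar hg).continuousAt.div (by fun_prop) (sub_ne_zero.2 hw)

/-- The integral of `dw / w` along the boundary of `[-T, T]²`, up to sign. -/
def squareIntegral (T : ℝ) : ℂ :=
  -(4 * T * I * ((∫ x in (-T)..T, 1 / (x ^ 2 + T ^ 2) : ℝ) : ℂ))

/-- The value is -2πi, but non-vanishing is all that is used, so positivity of the integrand
suffices. -/
theorem squareIntegral_ne_zero {T : ℝ} (hT : 0 < T) : squareIntegral T ≠ 0 := by
  have : 0 < ∫ x in (-T)..T, 1 / (x ^ 2 + T ^ 2) := by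
    apply intervalIntegral.intervalIntegral_pos_of_pos
    · apply Continuous.intervalIntegrable
      exact continuous_const.div (by fun_prop) fun x => by positivity
    · intro x; positivity
    · linarith
  refine neg_ne_zero.2 (mul_ne_zero ?_ (ofReal_ne_zero.2 this.ne'))
  simp [hT.ne', I_ne_zero]

theorem integral_inv_sub_inv {T : ℝ} (hT : 0 < T) :
    (∫ x : ℝ in (-T)..T, ((x : ℂ) - T * I)⁻¹) - (∫ x : ℝ in (-T)..T, ((x : ℂ) + T * I)⁻¹) =
      2 * T * I * ((∫ x in (-T)..T, 1 / (x ^ 2 + T ^ 2) : ℝ) : ℂ) := by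
  have h1 : ∀ x : ℝ, (x : ℂ) - T * I ≠ 0 := fun x h => by
    have := congrArg Complex.im h; simp at this; exact hT.ne' this
  have h2 : ∀ x : ℝ, (x : ℂ) + T * I ≠ 0 := fun x h => by
    have := congrArg Complex.im h; simp at this; exact hT.ne' this
  rw [← intervalIntegral.integral_sub, ← intervalIntegral.integral_ofReal,
    ← intervalIntegral.integral_const_mul]
  · refine intervalIntegral.integral_congr fun x _ => ?_
    have h3 : ((x : ℂ) ^ 2 + T ^ 2) ≠ 0 := by
      have : ((x : ℂ) - T * I) * ((x : ℂ) + T * I) = (x : ℂ) ^ 2 + T ^ 2 := by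
        linear_combination (-(T : ℂ) ^ 2) * I_sq
      rw [← this]; exact mul_ne_zero (h1 x) (h2 x)
    have := h1 x
    have := h2 x
    push_cast
    field_simp
    linear_combination (2 * (T : ℂ) ^ 3 * I) * I_sq
  · exact (Continuous.inv₀ (by fun_prop) h1).intervalIntegrable _ _
  · exact (Continuous.inv₀ (by fun_prop) h2).intervalIntegrable _ _

theorem integral_eq_iterated_of_support_subset {F : ℂ → ℂ} (hF : Continuous F) {T : ℝ}
    (hs : ∀ w, T ≤ ‖w‖ → F w = 0) :
    ∫ w, F w = ∫ x : ℝ in (-T)..T, ∫ y : ℝ in (-T)..T, F (x + y * I) := by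
  have hc : HasCompactSupport F := by
    refine HasCompactSupport.intro (isCompact_closedBall (0 : ℂ) T) fun w hw => hs w ?_
    simp at hw; exact hw.le
  have hint : Integrable F := hF.integrable_of_hasCompactSupport hc
  have hi2 := (volume_preserving_equiv_real_prod.symm).integrable_comp_emb
    (measurableEquivRealProd.symm.measurableEmbedding) |>.2 hint
  rw [← (volume_preserving_equiv_real_prod.symm).integral_comp
    measurableEquivRealProd.symm.measurableEmbedding, Measure.volume_eq_prod,
    integral_prod (fun p => F (measurableEquivRealProd.symm p)) hi2]
  have key : ∀ x y : ℝ, F (measurableEquivRealProd.symm (x, y)) = F (x + y * I) := fun x y => by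
    congr 1
    apply Complex.ext <;> simp
  simp only [key]
  rw [intervalIntegral.integral_eq_integral_of_support_subset]
  · refine integral_congr_ae (Eventually.of_forall fun x => ?_)
    dsimp only
    rw [intervalIntegral.integral_eq_integral_of_support_subset]
    intro y hy
    by_contra h
    refine hy (hs _ ?_)
    have : T ≤ |y| := by
      rw [Set.mem_Ioc, not_and_or] at h
      rcases h with h | h
      · rw [le_abs]; right; linarith
      · rw [le_abs]; left; linarith
    simpa using this.trans (abs_im_le_norm (x + y * I : ℂ) |>.trans_eq' (by simp))
  · intro x hx
    by_contra h
    refine hx ?_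
    have : T ≤ |x| := by
      rw [Set.mem_Ioc, not_and_or] at h
      rcases h with h | h
      · rw [le_abs]; right; linarith
      · rw [le_abs]; left; linarith
    refine (intervalIntegral.integral_congr (g := fun _ => (0 : ℂ)) fun y _ => hs _ ?_).trans
      (by simp)
    exact this.trans (abs_re_le_norm (x + y * I : ℂ) |>.trans_eq' (by simp))

/-- Green's formula on the square, applied to (g(w) - g(0))/w, which extends over 0 because g is
holomorphic there. Its `dbar` is that of g divided by w, and on the boundary g vanishes, leaving
-g(0)/w. -/
theorem integral_dbar_div_zero {T : ℝ} (hT : 0 < T) {g : ℂ → ℂ} (hg : ContDiff ℝ 1 g)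
    (hs : ∀ w, T ≤ ‖w‖ → g w = 0) (h0 : ∀ᶠ w in 𝓝 0, DifferentiableAt ℂ g w) :
    ∫ w, dbar g w / w = squareIntegral T * g 0 := by
  have hgd : Differentiable ℝ g := hg.differentiable one_ne_zero
  have hf0 : DifferentiableAt ℂ (dslope g 0) 0 := by
    obtain ⟨r, hr, hb⟩ := Metric.eventually_nhds_iff_ball.1 h0
    have : DifferentiableOn ℂ (dslope g 0) (Metric.ball 0 r) :=
      (differentiableOn_dslope (Metric.ball_mem_nhds 0 hr)).2 fun w hw =>
        (hb w hw).differentiableWithinAt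
    exact this.differentiableAt (Metric.ball_mem_nhds 0 hr)
  have hinv : ∀ w : ℂ, w ≠ 0 → DifferentiableAt ℂ (fun v : ℂ => v⁻¹) w := fun w hw =>
    differentiableAt_inv hw
  have hfe : ∀ w : ℂ, w ≠ 0 → dslope g 0 =ᶠ[𝓝 w] fun v => (g v - g 0) * v⁻¹ := fun w hw => by
    filter_upwards [isOpen_ne.mem_nhds hw] with v hv
    rw [dslope_of_ne _ hv, slope_def_field, sub_zero, div_eq_mul_inv]
  have hfd : ∀ w : ℂ, DifferentiableAt ℝ (dslope g 0) w := fun w => by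
    rcases eq_or_ne w 0 with rfl | hw
    · exact hf0.restrictScalars ℝ
    · exact (((hgd w).sub_const _).mul ((hinv w hw).restrictScalars ℝ)).congr_of_eventuallyEq
        (hfe w hw)
  have hdf : ∀ w : ℂ, dbar (dslope g 0) w = dbar g w / w := fun w => by
    rcases eq_or_ne w 0 with rfl | hw
    · rw [dbar_eq_zero hf0, dbar_eq_zero h0.self_of_nhds, zero_div]
    · rw [dbar_congr (hfe w hw), dbar_mul (hinv w hw) ((hgd w).sub_const _), div_eq_mul_inv]
      simp only [dbar, fderiv_sub_const]
  have hcont : Continuous fun w => dbar g w / w := by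
    simpa using continuous_dbar_div hg h0
  have hs' : ∀ w, T ≤ ‖w‖ → dbar g w / w = 0 := by
    -- Local vanishing of g gives this only for `T < ‖w‖`; continuity adds the circle itself.
    have hcl : IsClosed {w : ℂ | dbar g w / w = 0} := isClosed_eq hcont continuous_const
    intro w hw
    have h1 : w ∈ closure (Metric.closedBall (0 : ℂ) T)ᶜ := by
      rw [closure_compl, interior_closedBall _ hT.ne']
      simpa using hw
    refine hcl.closure_subset_iff.2 (fun v hv => ?_) h1
    have hz : g =ᶠ[𝓝 v] fun _ => 0 := by
      filter_upwards [Metric.isClosed_closedBall.isOpen_compl.mem_nhds hv] with u hu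
      simp only [Set.mem_compl_iff, Metric.mem_closedBall, dist_zero_right, not_le] at hu
      exact hs u hu.le
    rw [Set.mem_ofPred_eq, dbar_congr hz]
    simp [dbar]
  have hb : ∀ w : ℂ, T ≤ ‖w‖ → dslope g 0 w = -g 0 * w⁻¹ := fun w hw => by
    rw [(hfe w (norm_pos_iff.1 (hT.trans_le hw))).self_of_nhds]
    simp only [hs w hw, zero_sub]
  have hre : ∀ a b : ℝ, |a| = T → T ≤ ‖(a + b * I : ℂ)‖ := fun a b h => by
    rw [← h]; simpa using abs_re_le_norm (a + b * I : ℂ)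
  have him : ∀ a b : ℝ, |b| = T → T ≤ ‖(a + b * I : ℂ)‖ := fun a b h => by
    rw [← h]; simpa using abs_im_le_norm (a + b * I : ℂ)
  have hTT : |T| = T := abs_of_pos hT
  have hnTT : |-T| = T := by rw [abs_neg, hTT]
  have key := integral_boundary_rect_of_differentiableOn_real (dslope g 0)
    (-T + (-T : ℝ) * I) (T + T * I) (fun w _ => (hfd w).differentiableWithinAt)
    ((show Continuous (fun w => dbar (dslope g 0) w) by
      simpa only [hdf] using hcont).continuousOn.integrableOn_compact
        (isCompact_uIcc.reProdIm isCompact_uIcc))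
  have e1 : ∀ x y : ℝ, I * fderiv ℝ (dslope g 0) (x + y * I) 1 -
      fderiv ℝ (dslope g 0) (x + y * I) I = dbar g (x + y * I) / (x + y * I) := fun x y => hdf _
  simp only [smul_eq_mul, e1] at key
  simp only [add_re, neg_re, ofReal_re, mul_re, I_re, mul_zero, ofReal_im, I_im,
    sub_zero, add_zero, add_im, neg_im, mul_im, mul_one, neg_zero, zero_add] at key
  rw [← integral_eq_iterated_of_support_subset hcont hs'] at key
  rw [← key]
  have c1 : ∀ x : ℝ, dslope g 0 (x + (-T : ℝ) * I) = -g 0 * ((x : ℂ) - T * I)⁻¹ := fun x => by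
    rw [hb _ (him _ _ hnTT)]; push_cast; ring_nf
  have c2 : ∀ x : ℝ, dslope g 0 (x + T * I) = -g 0 * ((x : ℂ) + T * I)⁻¹ := fun x => by
    rw [hb _ (him _ _ hTT)]
  have c3 : ∀ y : ℝ, dslope g 0 (T + y * I) = g 0 * I * ((y : ℂ) - T * I)⁻¹ := fun y => by
    rw [hb _ (hre _ _ hTT)]
    have : (T + y * I : ℂ) = I * ((y : ℂ) - T * I) := by linear_combination (T : ℂ) * I_sq
    rw [this, mul_inv, inv_I]; ring
  have c4 : ∀ y : ℝ, dslope g 0 ((-T : ℝ) + y * I) = g 0 * I * ((y : ℂ) + T * I)⁻¹ := fun y => by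
    rw [hb _ (hre _ _ hnTT)]
    have : ((-T : ℝ) + y * I : ℂ) = I * ((y : ℂ) + T * I) := by
      push_cast; linear_combination (-(T : ℂ)) * I_sq
    rw [this, mul_inv, inv_I]; ring
  simp only [c1, c2, c3, c4, intervalIntegral.integral_const_mul]
  have := integral_inv_sub_inv hT
  rw [squareIntegral]
  linear_combination (-g 0 + g 0 * I ^ 2) * this +
    (2 * T * I * ((∫ x in (-T)..T, 1 / (x ^ 2 + T ^ 2) : ℝ) : ℂ) * g 0) * I_sq

/-- A form of the Cauchy–Pompeiu formula. -/
theorem integral_dbar_div {T : ℝ} (hT : 0 < T) {g : ℂ → ℂ} {z : ℂ} (hg : ContDiff ℝ 1 g)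
    (hs : ∀ w, T ≤ ‖w - z‖ → g w = 0) (hz : ∀ᶠ w in 𝓝 z, DifferentiableAt ℂ g w) :
    ∫ w, dbar g w / (w - z) = squareIntegral T * g z := by
  have h := integral_dbar_div_zero hT (g := fun w => g (w + z)) (hg.comp (by fun_prop))
    (fun w hw => hs _ (by simpa using hw)) ?_
  · rw [zero_add] at h
    rw [← h, ← integral_add_right_eq_self _ z]
    refine integral_congr_ae (Eventually.of_forall fun w => ?_)
    simp only [dbar, fderiv_comp_add_right, add_sub_cancel_right]
  · have : Tendsto (fun w => w + z) (𝓝 0) (𝓝 z) := by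
      simpa using (continuous_add_const z).tendsto (0 : ℂ)
    filter_upwards [this.eventually hz] with w hw
    exact (differentiableAt_comp_add_const).2 hw

end UniversalPade

/-! ### Logarithms, bounded components of the complement, and Runge's theorem -/

namespace UniversalPade

open MeasureTheory Complex

/-- If the differential of `χ` is supported where `G` is holomorphic, then
`∫ ∂χ/∂z̄ · G' = 0`, because `dχ ∧ dG` is exact. -/
theorem integral_dbar_mul_deriv_eq_zero {χ G : ℂ → ℂ} {N : Set ℂ} (hN : IsOpen N)
    (hG : DifferentiableOn ℂ G N) (hχ : ContDiff ℝ 2 χ) (hc : HasCompactSupport χ)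
    (hs : ∀ w ∉ N, ∀ᶠ v in 𝓝 w, fderiv ℝ χ v = 0) :
    ∫ w, dbar χ w * deriv G w = 0 := by
  have hχ1 : ContDiff ℝ 1 (fderiv ℝ χ) := hχ.fderiv_right (by norm_num)
  have hu : ∀ v : ℂ, ContDiff ℝ 1 fun w => fderiv ℝ χ w v := fun v =>
    hχ1.clm_apply contDiff_const
  have huc : ∀ v : ℂ, HasCompactSupport fun w => fderiv ℝ χ w v := fun v => hc.fderiv_apply ℝ v
  have hut : ∀ v : ℂ, tsupport (fun w => fderiv ℝ χ w v) ⊆ N := fun v w hw => by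
    by_contra h
    refine notMem_tsupport_iff_eventuallyEq.2 ?_ hw
    filter_upwards [hs w h] with u hu
    simp [hu]
  have hut' : ∀ v v' : ℂ, tsupport (fun w => fderiv ℝ (fun w => fderiv ℝ χ w v) w v') ⊆ N :=
    fun v v' => (tsupport_fderiv_apply_subset ℝ v').trans (hut v)
  have hGc : ContinuousOn G N := hG.continuousOn
  have hG'c : ContinuousOn (deriv G) N := (hG.deriv hN).continuousOn
  have hmul : ∀ {f u : ℂ → ℂ}, ContinuousOn f N → Continuous u → HasCompactSupport u →
      tsupport u ⊆ N → Integrable fun w => f w * u w := fun {f u} hf hu huc hut => by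
    refine Continuous.integrable_of_hasCompactSupport (continuous_of_tsupport fun w hw => ?_)
      huc.mul_left
    have hw' : w ∈ N := hut (tsupport_mul_subset_right hw)
    exact (hf.continuousAt (hN.mem_nhds hw')).mul hu.continuousAt
  have hfd : ∀ w ∈ N, ∀ v : ℂ, fderiv ℝ G w v = v * deriv G w := fun w hw v => by
    have := (hG.differentiableAt (hN.mem_nhds hw)).fderiv_restrictScalars ℝ
    rw [this, ContinuousLinearMap.coe_restrictScalars', fderiv_eq_smul_deriv, smul_eq_mul]
  have hfc : ∀ v : ℂ, ContinuousOn (fun w => fderiv ℝ G w v) N := fun v =>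
    (continuousOn_const.mul hG'c).congr fun w hw => hfd w hw v
  have hu2 : ∀ v v' : ℂ, Continuous fun w => fderiv ℝ (fun w => fderiv ℝ χ w v) w v' :=
    fun v v' => ((hu v).continuous_fderiv one_ne_zero).clm_apply continuous_const
  have hparts : ∀ v v' : ℂ, ∫ w, G w * fderiv ℝ (fun w => fderiv ℝ χ w v) w v' =
      -∫ w, v' * (deriv G w * fderiv ℝ χ w v) := fun v v' => by
    rw [integral_mul_fderiv_eq_neg_fderiv_mul_of_integrable
      (hmul (hfc v') (hu v).continuous (huc v) (hut v))
      (hmul hGc (hu2 v v') ((huc v).fderiv_apply ℝ v') (hut' v v'))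
      (hmul hGc (hu v).continuous (huc v) (hut v))
      (fun w hw => (hG.differentiableAt (hN.mem_nhds (hut v hw))).restrictScalars ℝ)
      (fun w _ => (hu v).differentiable one_ne_zero w)]
    congr 1
    refine integral_congr_ae (Eventually.of_forall fun w => ?_)
    by_cases hw : w ∈ N
    · simp only [hfd w hw, mul_assoc]
    · simp [(hs w hw).self_of_nhds]
  have hsymm : ∀ w, fderiv ℝ (fun w => fderiv ℝ χ w I) w 1 =
      fderiv ℝ (fun w => fderiv ℝ χ w 1) w I := fun w => by
    have h1 := (hχ1.differentiable one_ne_zero w)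
    have h2 := (hχ.contDiffAt (x := w)).isSymmSndFDerivAt (by simp)
    have := h2.eq 1 I
    rw [fderiv_clm_apply h1 (differentiableAt_const _),
      fderiv_clm_apply h1 (differentiableAt_const _)]
    simpa using this
  -- Both mixed second derivatives of χ are integrated by parts against G. Since they agree, ∫ G'
  -- χ_y = ∫ i G' χ_x, which is the claim.
  have h1 := hparts I 1
  have h2 := hparts 1 I
  simp only [hsymm] at h1
  rw [h1, neg_inj] at h2
  have i1 := hmul hG'c (hu I).continuous (huc I) (hut I)
  have i2 := hmul hG'c (hu 1).continuous (huc 1) (hut 1)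
  have : ∀ w, dbar χ w * deriv G w =
      I * (deriv G w * fderiv ℝ χ w 1) - 1 * (deriv G w * fderiv ℝ χ w I) := fun w => by
    rw [dbar]; ring
  simp only [this]
  rw [integral_sub (i2.const_mul _) (i1.const_mul _), h2, sub_self]

/-- `z - a` has a holomorphic logarithm in a neighbourhood of `S`. -/
def HasLog (S : Set ℂ) (a : ℂ) : Prop :=
  ∃ (N : Set ℂ) (G : ℂ → ℂ), IsOpen N ∧ S ⊆ N ∧ DifferentiableOn ℂ G N ∧
    ∀ z ∈ N, exp (G z) = z - a

/-- If the component V of a were bounded, a cutoff χ could be chosen with support in V and equal to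
1 near the part of the closure of V outside N. Then dχ lives where G' = 1/(z - a), so the integral
of `dbar χ w / (w - a)` vanishes; by Cauchy–Pompeiu it is a non-zero multiple of χ(a) = 1. -/
theorem HasLog.not_isBounded_connectedComponentIn {S : Set ℂ} (hS : IsCompact S) {a : ℂ}
    (ha : a ∉ S) (h : HasLog S a) : ¬ Bornology.IsBounded (connectedComponentIn Sᶜ a) := by
  intro hb
  obtain ⟨N, G, hN, hSN, hG, hexp⟩ := h
  have haN : a ∉ N := fun h => exp_ne_zero _ ((hexp a h).trans (sub_self a))
  set V := connectedComponentIn Sᶜ a with hV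
  have haV : a ∈ V := mem_connectedComponentIn ha
  have hVo : IsOpen V := hS.isClosed.isOpen_compl.connectedComponentIn
  have hZV : closure V \ N ⊆ V := fun x hx => by
    have : insert x V ⊆ V := by
      refine (IsPreconnected.subset_connectedComponentIn ?_ (Set.mem_insert_of_mem _ haV) ?_)
      · exact isPreconnected_connectedComponentIn.subset_closure (Set.subset_insert _ _)
          (Set.insert_subset hx.1 subset_closure)
      · exact Set.insert_subset (fun h => hx.2 (hSN h)) (connectedComponentIn_subset _ _)
    exact this (Set.mem_insert _ _)
  obtain ⟨χ, hχ, hc, hsV, h1⟩ := exists_contDiff_cutoff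
    (hb.isCompact_closure.diff hN) hVo hZV
  have hs : ∀ w ∉ N, ∀ᶠ v in 𝓝 w, fderiv ℝ χ v = 0 := fun w hw => by
    by_cases hw' : w ∈ tsupport χ
    · filter_upwards [(h1 w ⟨subset_closure (hsV hw'), hw⟩).eventually_nhds] with v hv
      rw [EventuallyEq.fderiv_eq (f := fun _ => 1) hv]
      simp
    · filter_upwards [(isClosed_tsupport χ).isOpen_compl.mem_nhds hw'] with v hv
      by_contra h
      exact hv (support_fderiv_subset ℝ h)
  have h0 := integral_dbar_mul_deriv_eq_zero hN hG hχ hc hs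
  obtain ⟨T, hT, hTs⟩ := hc.isCompact.isBounded.subset_closedBall_lt 0 a
  have h2 := integral_dbar_div (T := T + 1) (z := a) (by linarith) (hχ.of_le (by norm_num))
    (fun w hw => by
      by_contra h
      have := hTs (subset_tsupport _ h)
      rw [Metric.mem_closedBall, dist_eq_norm] at this
      linarith)
    (by
      filter_upwards [(h1 a ⟨subset_closure haV, haN⟩).eventually_nhds] with v hv
      exact (differentiableAt_const (1 : ℂ)).congr_of_eventuallyEq hv)
  rw [(h1 a ⟨subset_closure haV, haN⟩).self_of_nhds, mul_one] at h2
  refine squareIntegral_ne_zero (T := T + 1) (by linarith) (h2.symm.trans (Eq.trans ?_ h0))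
  refine integral_congr_ae (Eventually.of_forall fun w => ?_)
  dsimp only
  by_cases hw : w ∈ N
  · have hd := (hG.differentiableAt (hN.mem_nhds hw)).hasDerivAt.cexp
    have hd2 : HasDerivAt (fun z => exp (G z)) 1 w := by
      refine ((hasDerivAt_id w).sub_const a).congr_of_eventuallyEq ?_
      filter_upwards [hN.mem_nhds hw] with v hv using hexp v hv
    have := hd.unique hd2
    rw [hexp w hw] at this
    rw [div_eq_mul_inv, eq_inv_of_mul_eq_one_right this]
  · simp [dbar, (hs w hw).self_of_nhds]

/-- Project to the quotient by the closed subspace: the projection commutes with the integral and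
kills the integrand. -/
theorem integral_mem_of_isClosed {E : Type*} [NormedAddCommGroup E] [NormedSpace ℂ E]
    [CompleteSpace E] (A : Submodule ℂ E) (hA : IsClosed (A : Set E)) {α : Type*}
    [MeasurableSpace α] {μ : Measure α} {f : α → E} (hf : Integrable f μ) (h : ∀ x, f x ∈ A) :
    ∫ x, f x ∂μ ∈ A := by
  have : IsClosed (A : Set E) := hA
  have key := (A.mkQL).integral_comp_comm hf
  have h0 : ∀ x, A.mkQL (f x) = 0 := fun x => (Submodule.Quotient.mk_eq_zero A).2 (h x)
  simp only [h0, integral_zero] at key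
  exact (Submodule.Quotient.mk_eq_zero A).1 key.symm

/-- The spectrum of z in C(S) is S, and passing to a closed subalgebra can only fill in bounded
components of the complement. So w - z stays invertible in the closure of the polynomials. A point
of S has an empty component, which is bounded, so the hypothesis excludes it. -/
theorem exists_resolvent_mem_closure {S : Set ℂ} [CompactSpace S] {w : ℂ}
    (hb : ¬ Bornology.IsBounded (connectedComponentIn Sᶜ w)) :
    ∃ r ∈ (polynomialFunctions S).topologicalClosure, ∀ z : S, r z * (w - z) = 1 := by
  have hAc : IsClosed ((polynomialFunctions S).topologicalClosure : Set C(S, ℂ)) :=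
    Subalgebra.isClosed_topologicalClosure _
  have hXA : Polynomial.toContinuousMapOn (X : ℂ[X]) S ∈
      (polynomialFunctions S).topologicalClosure :=
    Subalgebra.le_topologicalClosure _ ⟨X, trivial, rfl⟩
  have hrange : Set.range (Polynomial.toContinuousMapOn (X : ℂ[X]) S) = S := by
    ext v; simp
  have hw' : w ∉ spectrum ℂ
      (⟨_, hXA⟩ : (polynomialFunctions S).topologicalClosure) := fun h => by
    have := Subalgebra.spectrum_isBounded_connectedComponentIn _ _ h
    rw [ContinuousMap.spectrum_eq_range, hrange] at this
    exact hb this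
  obtain ⟨u, hu⟩ := spectrum.notMem_iff.1 hw'
  refine ⟨_, (u⁻¹).1.2, fun z => ?_⟩
  have := congrArg (fun f : (polynomialFunctions S).topologicalClosure => f.1 z) u.inv_mul
  rw [hu] at this
  simpa [Algebra.algebraMap_eq_smul_one] using this

theorem exists_polynomial_near_of_integral {S : Set ℂ} [CompactSpace S] {W : ℂ → C(S, ℂ)}
    (hWi : Integrable W) (hWA : ∀ w, W w ∈ (polynomialFunctions S).topologicalClosure) (c : ℂ)
    {F : ℂ → ℂ} (hF : ∀ z : S, c * ∫ w, W w z = F z) {ε : ℝ} (hε : 0 < ε) :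
    ∃ P : ℂ[X], ∀ z ∈ S, ‖P.eval z - F z‖ < ε := by
  have hQA : c • ∫ w, W w ∈ (polynomialFunctions S).topologicalClosure :=
    Subalgebra.smul_mem _ (integral_mem_of_isClosed
      (Subalgebra.toSubmodule (polynomialFunctions S).topologicalClosure)
      (Subalgebra.isClosed_topologicalClosure _) hWi hWA) _
  have hQ : ∀ z : S, (c • ∫ w, W w) z = F z := fun z => by
    rw [ContinuousMap.smul_apply, ContinuousMap.integral_apply hWi, smul_eq_mul, hF]
  obtain ⟨_, ⟨P, -, rfl⟩, hf⟩ := Metric.mem_closure_iff.1 hQA ε hε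
  refine ⟨P, fun z hz => ?_⟩
  rw [← hQ ⟨z, hz⟩, norm_sub_rev, ← dist_eq_norm]
  exact (ContinuousMap.dist_apply_le_dist (g := toContinuousMapOnAlgHom S P) ⟨z, hz⟩).trans_lt hf

/-- **Runge's theorem** for polynomial approximation. -/
theorem exists_polynomial_near {S N : Set ℂ} (hS : IsCompact S) (hN : IsOpen N) (hSN : S ⊆ N)
    {F : ℂ → ℂ} (hF : DifferentiableOn ℂ F N)
    (hcomp : ∀ a ∉ S, ¬ Bornology.IsBounded (connectedComponentIn Sᶜ a)) {ε : ℝ} (hε : 0 < ε) :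
    ∃ P : ℂ[X], ∀ z ∈ S, ‖P.eval z - F z‖ < ε := by
  have : CompactSpace S := isCompact_iff_compactSpace.1 hS
  obtain ⟨χ, hχ, hc, hsN, h1⟩ := exists_contDiff_cutoff hS hN hSN
  set g : ℂ → ℂ := fun z => χ z * F z with hg
  have hgd : ContDiff ℝ 1 g := by
    refine contDiff_iff_contDiffAt.2 fun w => ?_
    by_cases hw : w ∈ tsupport g
    swap
    · exact contDiffAt_const.congr_of_eventuallyEq (notMem_tsupport_iff_eventuallyEq.1 hw)
    have hw' : w ∈ N := hsN (tsupport_mul_subset_left hw)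
    exact (hχ.of_le (by norm_num)).contDiffAt.mul
      ((hF.contDiffOn hN).contDiffAt (hN.mem_nhds hw') |>.restrict_scalars ℝ)
  have hgz : ∀ z ∈ S, ∀ᶠ w in 𝓝 z, DifferentiableAt ℂ g w := fun z hz => by
    filter_upwards [(h1 z hz).eventually_nhds, hN.mem_nhds (hSN hz)] with w hw hwN
    refine (hF.differentiableAt (hN.mem_nhds hwN)).congr_of_eventuallyEq ?_
    filter_upwards [hw] with v hv
    simp [hg, hv]
  have hgF : ∀ z ∈ S, g z = F z := fun z hz => by simp [hg, (h1 z hz).self_of_nhds]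
  have hgc : HasCompactSupport g := hc.mul_right
  obtain ⟨T, hT, hTs⟩ := (hgc.isCompact.isBounded.union hS.isBounded).subset_closedBall_lt 0 0
  -- Both S and the support of g lie in the disc of radius T about 0, so points of the two are at
  -- distance at most 2T.
  have hCP : ∀ z ∈ S, ∫ w, dbar g w / (w - z) = squareIntegral (2 * T + 1) * F z := fun z hz => by
    rw [integral_dbar_div (T := 2 * T + 1) (by linarith) hgd (fun w hw => ?_) (hgz z hz), hgF z hz]
    by_contra h
    have h2 := hTs (Or.inl (subset_tsupport _ h))
    have h3 := hTs (Or.inr hz)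
    rw [mem_closedBall_zero_iff] at h2 h3
    linarith [norm_sub_le w z]
  have hcont : Continuous fun p : ℂ × S => dbar g p.1 / (p.1 - p.2) := by
    rw [continuous_iff_continuousAt]
    rintro ⟨w, z⟩
    by_cases hw : w ∈ S
    · refine (continuousAt_const (y := (0 : ℂ))).congr ?_
      filter_upwards [continuousAt_fst.eventually (hgz w hw)] with p hp
      simp [dbar_eq_zero hp]
    · refine ((continuous_dbar hgd).comp continuous_fst).continuousAt.div (by fun_prop) ?_
      exact sub_ne_zero.2 fun h => hw ((show w = z from h) ▸ z.2)
  -- The Cauchy–Pompeiu integrand becomes one continuous function with values in C(S). Each value is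
  -- a multiple of a resolvent, or zero for w in S, hence a limit of polynomials; so is the
  -- integral.
  obtain ⟨W, hW, hWc⟩ : ∃ W : ℂ → C(S, ℂ), (∀ w z, W w z = dbar g w / (w - z)) ∧ Continuous W :=
    ⟨(ContinuousMap.curry ⟨_, hcont⟩), fun _ _ => rfl, ContinuousMap.continuous _⟩
  have hWA : ∀ w, W w ∈ (polynomialFunctions S).topologicalClosure := fun w => by
    by_cases hw : w ∈ S
    · have : W w = 0 := by
        ext z; simp [hW, dbar_eq_zero (hgz w hw).self_of_nhds]
      rw [this]; exact zero_mem _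
    · obtain ⟨r, hr, hrw⟩ := exists_resolvent_mem_closure (hcomp w hw)
      have : W w = dbar g w • r := by
        ext z
        simp [hW, div_eq_mul_inv, eq_inv_of_mul_eq_one_left (hrw z)]
      rw [this]
      exact Subalgebra.smul_mem _ hr _
  have hWi : Integrable W := by
    refine hWc.integrable_of_hasCompactSupport ((hasCompactSupport_dbar hgc).mono fun w hw h => ?_)
    refine hw (ContinuousMap.ext fun z => ?_)
    simp [hW, h]
  have hc0 := squareIntegral_ne_zero (T := 2 * T + 1) (by linarith)
  refine exists_polynomial_near_of_integral hWi hWA (squareIntegral (2 * T + 1))⁻¹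
    (fun z => ?_) hε
  simp only [hW]
  rw [hCP z z.2]
  exact inv_mul_cancel_left₀ hc0 _

end UniversalPade

/-! ### Constructing logarithms; simultaneous polynomial approximation -/

namespace UniversalPade

open Complex

theorem HasLog.of_forall_norm_lt {S : Set ℂ} {a : ℂ} (h : ∀ z ∈ S, ‖z‖ < ‖a‖) : HasLog S a := by
  refine ⟨{z | ‖z‖ < ‖a‖}, fun z => log (-a) + log (1 + -z / a),
    isOpen_lt continuous_norm continuous_const, h, fun z hz => ?_, fun z hz => ?_⟩
  all_goals
    have ha : a ≠ 0 := norm_pos_iff.1 ((norm_nonneg z).trans_lt hz)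
    have hs : 1 + -z / a ∈ slitPlane := mem_slitPlane_of_norm_lt_one (by
      rw [norm_div, norm_neg, div_lt_one (norm_pos_iff.2 ha)]; exact hz)
  · refine DifferentiableAt.differentiableWithinAt ?_
    exact (differentiableAt_const _).add (DifferentiableAt.clog (by fun_prop) hs)
  · rw [exp_add, exp_log (neg_ne_zero.2 ha), exp_log (slitPlane_ne_zero hs)]
    field_simp
    ring

/-- Factor z - b = (z - a)(1 + (a - b)/(z - a)); the second factor stays in the disc of radius 1
about 1, where the principal logarithm is holomorphic. -/
theorem HasLog.of_forall_norm_sub_lt {S : Set ℂ} {a b : ℂ} (ha : HasLog S a)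
    (h : ∀ z ∈ S, ‖a - b‖ < ‖z - a‖) : HasLog S b := by
  obtain ⟨N, G, hN, hSN, hG, hexp⟩ := ha
  have hopen : IsOpen {z : ℂ | ‖a - b‖ < ‖z - a‖} := isOpen_lt continuous_const (by fun_prop)
  refine ⟨N ∩ {z | ‖a - b‖ < ‖z - a‖}, fun z => G z + log (1 + (a - b) / (z - a)),
    hN.inter hopen, fun z hz => ⟨hSN hz, h z hz⟩, fun z hz => ?_, fun z hz => ?_⟩
  all_goals
    have hz' : ‖a - b‖ < ‖z - a‖ := hz.2
    have hza : z - a ≠ 0 := norm_pos_iff.1 ((norm_nonneg _).trans_lt hz')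
    have hs : 1 + (a - b) / (z - a) ∈ slitPlane := mem_slitPlane_of_norm_lt_one (by
      rw [norm_div, div_lt_one (norm_pos_iff.2 hza)]; exact hz')
  · refine DifferentiableAt.differentiableWithinAt ?_
    refine (hG.differentiableAt (hN.mem_nhds hz.1)).add (DifferentiableAt.clog ?_ hs)
    exact (differentiableAt_const _).add ((differentiableAt_const _).div (by fun_prop) hza)
  · rw [exp_add, hexp z hz.1, exp_log (slitPlane_ne_zero hs)]
    field_simp
    ring

theorem HasLog.of_isPreconnected_compl {S : Set ℂ} (hS : IsCompact S) (hc : IsPreconnected Sᶜ)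
    {a : ℂ} (ha : a ∉ S) : HasLog S a := by
  have hball : ∀ b ∉ S, ∃ r > 0, ∀ z ∈ S, r ≤ ‖z - b‖ := fun b hb => by
    obtain ⟨r, hr, h⟩ := Metric.isOpen_iff.1 hS.isClosed.isOpen_compl b hb
    refine ⟨r, hr, fun z hz => ?_⟩
    by_contra! hlt
    exact h (by rwa [Metric.mem_ball, dist_eq_norm]) hz
  have hsub : Sᶜ ⊆ {b | b ∉ S ∧ HasLog S b} := by
    refine hc.subset_of_closure_inter_subset ?_ ?_ ?_
    · rw [Metric.isOpen_iff]
      rintro b ⟨hb, hlog⟩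
      obtain ⟨r, hr, h⟩ := hball b hb
      refine ⟨r, hr, fun c hc => ?_⟩
      rw [Metric.mem_ball, dist_comm, dist_eq_norm] at hc
      refine ⟨fun hcS => ?_, hlog.of_forall_norm_sub_lt fun z hz => hc.trans_le (h z hz)⟩
      have := h c hcS
      rw [norm_sub_rev] at this
      linarith
    · obtain ⟨R, hR, hSR⟩ := hS.isBounded.subset_closedBall_lt 0 0
      have hlt : ∀ z ∈ S, ‖z‖ < ‖((R + 1 : ℝ) : ℂ)‖ := fun z hz => by
        have := hSR hz
        rw [mem_closedBall_zero_iff] at this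
        rw [norm_real, Real.norm_of_nonneg (by linarith)]
        linarith
      have hn : ((R + 1 : ℝ) : ℂ) ∉ S := fun h => lt_irrefl _ (hlt _ h)
      exact ⟨_, hn, hn, HasLog.of_forall_norm_lt hlt⟩
    · rintro b ⟨hb, hbS⟩
      refine ⟨hbS, ?_⟩
      obtain ⟨r, hr, h⟩ := hball b hbS
      obtain ⟨c, ⟨-, hc⟩, hbc⟩ := Metric.mem_closure_iff.1 hb (r / 2) (half_pos hr)
      rw [dist_eq_norm] at hbc
      refine hc.of_forall_norm_sub_lt fun z hz => ?_
      have h1 := h z hz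
      have h2 := norm_add_le (z - c) (c - b)
      rw [sub_add_sub_cancel] at h2
      rw [norm_sub_rev c b] at *
      linarith
  exact (hsub ha).2

theorem exists_differentiableOn_piecewise {U V : Set ℂ} (hU : IsOpen U)
    (hV : IsOpen V) (hUV : Disjoint U V) {f g : ℂ → ℂ} (hf : DifferentiableOn ℂ f U)
    (hg : DifferentiableOn ℂ g V) :
    ∃ F : ℂ → ℂ, DifferentiableOn ℂ F (U ∪ V) ∧ Set.EqOn F f U ∧ Set.EqOn F g V := by
  classical
  have h1 : Set.EqOn (U.piecewise f g) f U := Set.piecewise_eqOn _ _ _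
  have h2 : Set.EqOn (U.piecewise f g) g V := fun z hz =>
    Set.piecewise_eq_of_notMem _ _ _ (hUV.symm.notMem_of_mem_left hz)
  exact ⟨_, (hf.congr h1).union_of_isOpen (hg.congr h2) hU hV, h1, h2⟩

theorem HasLog.union {S T : Set ℂ} (hS : IsCompact S) (hT : IsCompact T) (hd : Disjoint S T)
    {a : ℂ} (h₁ : HasLog S a) (h₂ : HasLog T a) : HasLog (S ∪ T) a := by
  obtain ⟨U, V, hU, hV, hSU, hTV, hUV⟩ := SeparatedNhds.of_isCompact_isCompact hS hT hd
  obtain ⟨N₁, G₁, hN₁, hSN₁, hG₁, he₁⟩ := h₁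
  obtain ⟨N₂, G₂, hN₂, hSN₂, hG₂, he₂⟩ := h₂
  obtain ⟨G, hG, e₁, e₂⟩ := exists_differentiableOn_piecewise (hU.inter hN₁)
    (hV.inter hN₂) (hUV.mono Set.inter_subset_left Set.inter_subset_left)
    (hG₁.mono Set.inter_subset_right) (hG₂.mono Set.inter_subset_right)
  refine ⟨_, G, (hU.inter hN₁).union (hV.inter hN₂), Set.union_subset_union
    (Set.subset_inter hSU hSN₁) (Set.subset_inter hTV hSN₂), hG, ?_⟩
  rintro z (hz | hz)
  · rw [e₁ hz, he₁ z hz.2]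
  · rw [e₂ hz, he₂ z hz.2]

theorem HasLog.of_isSimplyConnected {Ω L : Set ℂ} (hΩo : IsOpen Ω) (hΩ : IsSimplyConnected Ω)
    (hL : L ⊆ Ω) {a : ℂ} (ha : a ∉ Ω) : HasLog L a := by
  obtain ⟨G, hG, he⟩ := exists_continuousOn_eqOn_exp_comp hΩ hΩo (g := fun z => z - a)
    (by fun_prop) (by rintro ⟨z, hz, h⟩; exact ha (sub_eq_zero.1 h ▸ hz))
  refine ⟨Ω, G, hΩo, hL, fun z hz => ?_, he⟩
  have ht : Tendsto (fun y : ℂ => y + a) (𝓝 (z - a)) (𝓝 z) := by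
    simpa using (continuous_add_const a).tendsto (z - a)
  -- Shifting by a makes G a continuous local right inverse of `exp`, which is therefore
  -- differentiable.
  have hd : HasDerivAt (fun y => G (y + a)) (exp (G z))⁻¹ (z - a) := by
    refine HasDerivAt.of_local_left_inverse (f := exp) ?_ (by simpa using hasDerivAt_exp (G z))
      (exp_ne_zero _) ?_
    · refine ContinuousAt.comp (g := G) ?_ (by fun_prop)
      simpa using hG.continuousAt (hΩo.mem_nhds hz)
    · filter_upwards [ht.eventually (hΩo.mem_nhds hz)] with y hy
      simpa using he hy
  have := hd.comp_sub_const (x := z) (a := a)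
  simpa using this.differentiableAt.differentiableWithinAt

/-- The points of the closed disc of radius `R` at distance at least `δ` from `Ωᶜ`. -/
def innerCompact (Ω : Set ℂ) (R δ : ℝ) : Set ℂ :=
  {z | ‖z‖ ≤ R ∧ ∀ a ∉ Ω, δ ≤ ‖z - a‖}

theorem isCompact_innerCompact (Ω : Set ℂ) (R δ : ℝ) : IsCompact (innerCompact Ω R δ) := by
  refine (isCompact_closedBall (0 : ℂ) R).of_isClosed_subset ?_ fun z hz => by simpa using hz.1
  simp only [innerCompact, Set.ofPred_and, Set.ofPred_forall]
  refine (isClosed_le continuous_norm continuous_const).inter ?_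
  exact isClosed_iInter fun a => isClosed_iInter fun _ => isClosed_le continuous_const (by fun_prop)

theorem innerCompact_subset {Ω : Set ℂ} {R δ : ℝ} (hδ : 0 < δ) : innerCompact Ω R δ ⊆ Ω :=
  fun z hz => by
    by_contra h
    have := hz.2 z h
    simp at this
    linarith

theorem exists_subset_innerCompact {Ω L : Set ℂ} (hΩo : IsOpen Ω) (hL : IsCompact L)
    (hLΩ : L ⊆ Ω) : ∃ R δ : ℝ, 0 < δ ∧ L ⊆ innerCompact Ω R δ := by
  obtain ⟨R, hR⟩ := hL.isBounded.subset_closedBall 0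
  obtain ⟨δ, hδ, h⟩ := hL.exists_thickening_subset_open hΩo hLΩ
  refine ⟨R, δ, hδ, fun z hz => ⟨by simpa using hR hz, fun a ha => ?_⟩⟩
  by_contra! hlt
  refine ha (h (Metric.mem_thickening_iff.2 ⟨z, hz, ?_⟩))
  rwa [dist_comm, dist_eq_norm]

/-- An arbitrary compact L in Ω may have holes; this larger set has none. A point off it is either
beyond radius R or within δ of some b outside Ω, and the logarithm of z - b transfers to it. -/
theorem HasLog.innerCompact {Ω : Set ℂ} (hΩo : IsOpen Ω) (hΩ : IsSimplyConnected Ω) {R δ : ℝ}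
    (hδ : 0 < δ) {a : ℂ} (ha : a ∉ innerCompact Ω R δ) : HasLog (innerCompact Ω R δ) a := by
  by_cases hR : R < ‖a‖
  · exact .of_forall_norm_lt fun z hz => hz.1.trans_lt hR
  have : ∃ b ∉ Ω, ‖a - b‖ < δ := by
    by_contra! h
    exact ha ⟨not_lt.1 hR, h⟩
  obtain ⟨b, hb, hab⟩ := this
  refine (HasLog.of_isSimplyConnected hΩo hΩ (innerCompact_subset hδ) hb).of_forall_norm_sub_lt
    fun z hz => ?_
  rw [norm_sub_rev]
  exact hab.trans_le (hz.2 b hb)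

/-- Simultaneous polynomial approximation of a holomorphic function on a compact subset of a simply
connected domain and of a polynomial on a compact set outside of it. -/
theorem exists_polynomial_near_near {Ω K L : Set ℂ} (hΩo : IsOpen Ω) (hΩ : IsSimplyConnected Ω)
    (hL : IsCompact L) (hLΩ : L ⊆ Ω) (hK : IsCompact K) (hKΩ : K ⊆ Ωᶜ) (hKc : IsPreconnected Kᶜ)
    {f : ℂ → ℂ} (hf : DifferentiableOn ℂ f Ω) (h : ℂ[X]) {ε : ℝ} (hε : 0 < ε) :
    ∃ P : ℂ[X], (∀ z ∈ L, ‖P.eval z - f z‖ < ε) ∧ ∀ z ∈ K, ‖P.eval z - h.eval z‖ < ε := by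
  obtain ⟨R, δ, hδ, hLM⟩ := exists_subset_innerCompact hΩo hL hLΩ
  have hM := isCompact_innerCompact Ω R δ
  have hMΩ : innerCompact Ω R δ ⊆ Ω := innerCompact_subset hδ
  have hd : Disjoint (innerCompact Ω R δ) K :=
    (disjoint_compl_right (a := Ω)).mono hMΩ hKΩ
  obtain ⟨U, V, hU, hV, hMU, hKV, hUV⟩ := SeparatedNhds.of_isCompact_isCompact hM hK hd
  obtain ⟨F, hF, e₁, e₂⟩ := exists_differentiableOn_piecewise (hU.inter hΩo)
    hV (hUV.mono_left Set.inter_subset_left) (hf.mono Set.inter_subset_right)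
    (h.differentiable.differentiableOn (s := V))
  obtain ⟨P, hP⟩ := exists_polynomial_near (hM.union hK) ((hU.inter hΩo).union hV)
    (Set.union_subset_union (Set.subset_inter hMU hMΩ) hKV) hF (fun a ha => by
      rw [Set.mem_union, not_or] at ha
      exact ((HasLog.innerCompact hΩo hΩ hδ ha.1).union hM hK hd
        (.of_isPreconnected_compl hK hKc ha.2)).not_isBounded_connectedComponentIn
        (hM.union hK) (by simp [ha])) hε
  refine ⟨P, fun z hz => ?_, fun z hz => ?_⟩
  · rw [← e₁ ⟨hMU (hLM hz), hLΩ hz⟩]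
    exact hP z (Or.inl (hLM hz))
  · rw [← show F z = h.eval z from e₂ (hKV hz)]
    exact hP z (Or.inr hz)

end UniversalPade

/-! ### Algebra of Padé approximants -/

namespace UniversalPade

/-- The linearised Padé condition in the variable `z - ζ`. -/
structure PadePair (a : ℂ⟦X⟧) (p q : ℕ) (A B : ℂ[X]) : Prop where
  natDegree_num_le : A.natDegree ≤ p
  natDegree_denom_le : B.natDegree ≤ q
  coeff_zero : B.coeff 0 = 1
  dvd : (PowerSeries.X : ℂ⟦X⟧) ^ (p + q + 1) ∣ a * B - A

/-- The coefficients of the normalised denominator in `𝔇_{p,q}`, without the constant one and in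
reverse order. -/
def denomVec (a : ℂ⟦X⟧) (p q : ℕ) : Fin q → ℂ :=
  (hankel a p q)⁻¹.mulVec fun i => -PowerSeries.coeff (p + 1 + i) a

/-- The normalised Padé denominator in the variable `z - ζ`. -/
def padeDenom (a : ℂ⟦X⟧) (p q : ℕ) : ℂ[X] :=
  1 + ∑ j : Fin q, C (denomVec a p q j) * X ^ (q - j)

/-- The Padé numerator in the variable `z - ζ`. -/
def padeNum (a : ℂ⟦X⟧) (p q : ℕ) : ℂ[X] :=
  PowerSeries.trunc (p + 1) (a * (padeDenom a p q : ℂ⟦X⟧))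

theorem natDegree_padeDenom_le (a : ℂ⟦X⟧) (p q : ℕ) : (padeDenom a p q).natDegree ≤ q := by
  refine (natDegree_add_le _ _).trans (max_le (by simp) ?_)
  refine natDegree_sum_le_of_forall_le _ _ fun j _ => ?_
  exact (natDegree_C_mul_X_pow_le _ _).trans (Nat.sub_le _ _)

theorem coeff_padeDenom_zero (a : ℂ⟦X⟧) (p q : ℕ) : (padeDenom a p q).coeff 0 = 1 := by
  rw [padeDenom, coeff_add, coeff_one_zero, finsetSum_coeff, Finset.sum_eq_zero, add_zero]
  intro j _
  rw [coeff_C_mul_X_pow, if_neg]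
  omega

theorem coeff_padeDenom_sub (a : ℂ⟦X⟧) (p q : ℕ) (j : Fin q) :
    (padeDenom a p q).coeff (q - j) = denomVec a p q j := by
  rw [padeDenom, coeff_add, coeff_one, if_neg (by omega), finsetSum_coeff, zero_add,
    Finset.sum_eq_single j]
  · simp
  · intro k _ hk
    rw [coeff_C_mul_X_pow, if_neg]
    intro h
    exact hk (Fin.ext (by omega))
  · simp

/-- Makes the vanishing of orders p+1, …, p+q of aB a linear system with the Hankel matrix, whose
unknowns are the coefficients of B in reverse order. -/
theorem coeff_mul_eq_hankel_mulVec (a : ℂ⟦X⟧) (p q : ℕ) {B : ℂ[X]} (hB : B.natDegree ≤ q)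
    (h0 : B.coeff 0 = 1) (i : Fin q) :
    PowerSeries.coeff (p + 1 + i) (a * (B : ℂ⟦X⟧)) = PowerSeries.coeff (p + 1 + i) a +
      (hankel a p q).mulVec (fun j => B.coeff (q - j)) i := by
  set n := p + 1 + (i : ℕ) with hn
  have h1 : PowerSeries.coeff n (a * (B : ℂ⟦X⟧)) =
      ∑ l ∈ Finset.range (q + 1), if n < l then 0 else B.coeff l * PowerSeries.coeff (n - l) a := by
    rw [mul_comm, PowerSeries.coeff_mul, Finset.Nat.sum_antidiagonal_eq_sum_range_succ_mk]
    simp only [coeff_coe]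
    -- Both sums are extended to the common range `n + 1 + q`; the new terms vanish because l > n or
    -- l > q.
    refine Eq.trans (Finset.sum_congr rfl fun l hl => ?_)
      ((Finset.sum_subset (Finset.range_mono (Nat.le_add_right (n + 1) q))
        fun l _ hl => ?_).trans (Finset.sum_subset (Finset.range_mono (by omega))
        fun l _ hl => ?_).symm)
    · rw [Finset.mem_range] at hl
      rw [if_neg (by omega)]
    · rw [Finset.mem_range] at hl
      rw [if_pos (by omega)]
    · rw [Finset.mem_range] at hl
      rw [coeff_eq_zero_of_natDegree_lt (by omega), zero_mul, ite_self]
  rw [h1, Finset.sum_range_succ', ← Finset.sum_range_reflect, Finset.sum_range]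
  rw [if_neg (by omega), h0, one_mul, Nat.sub_zero, add_comm]
  congr 1
  refine Finset.sum_congr rfl fun j _ => ?_
  have hj := j.2
  rw [show q - 1 - (j : ℕ) + 1 = q - j by omega]
  simp only [hankel, Matrix.of_apply]
  by_cases h : p + 1 + (i : ℕ) + j < q
  · rw [if_pos (by omega), if_pos h, zero_mul]
  · rw [if_neg (by omega), if_neg h, mul_comm, show n - (q - (j : ℕ)) = p + 1 + i + j - q by omega]

theorem padePair_padeNum_padeDenom {a : ℂ⟦X⟧} {p q : ℕ} (h : InD a p q) :
    PadePair a p q (padeNum a p q) (padeDenom a p q) := by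
  refine ⟨Nat.lt_succ_iff.1 (PowerSeries.natDegree_trunc_lt _ _), natDegree_padeDenom_le a p q,
    coeff_padeDenom_zero a p q, PowerSeries.X_pow_dvd_iff.2 fun v hv => ?_⟩
  rw [map_sub, coeff_coe, padeNum, PowerSeries.coeff_trunc]
  split_ifs with hvp
  · rw [sub_self]
  · obtain ⟨i, rfl⟩ := Nat.exists_eq_add_of_le (not_lt.1 hvp)
    have := coeff_mul_eq_hankel_mulVec a p q (natDegree_padeDenom_le a p q)
      (coeff_padeDenom_zero a p q) ⟨i, by omega⟩
    simp only [coeff_padeDenom_sub] at this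
    rw [this, sub_zero]
    have h2 : (hankel a p q).mulVec (denomVec a p q) =
        fun i : Fin q => -PowerSeries.coeff (p + 1 + i) a := by
      rw [denomVec, Matrix.mulVec_mulVec, Matrix.mul_nonsing_inv _ (isUnit_iff_ne_zero.2 h),
        Matrix.one_mulVec]
    rw [show (fun j => denomVec a p q j) = denomVec a p q from rfl, h2]
    simp

theorem PadePair.eq_of_inD {a : ℂ⟦X⟧} {p q : ℕ} (h : InD a p q) {A B : ℂ[X]}
    (hAB : PadePair a p q A B) : A = padeNum a p q ∧ B = padeDenom a p q := by
  have hdvd := PowerSeries.X_pow_dvd_iff.1 hAB.dvd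
  have hv : (fun j : Fin q => B.coeff (q - j)) = denomVec a p q := by
    have h1 : (hankel a p q).mulVec (fun j => B.coeff (q - j)) =
        fun i : Fin q => -PowerSeries.coeff (p + 1 + i) a := by
      funext i
      have h2 := hdvd (p + 1 + i) (by omega)
      rw [map_sub, coeff_coe, coeff_eq_zero_of_natDegree_lt (by
        have := hAB.natDegree_num_le; omega), sub_zero, coeff_mul_eq_hankel_mulVec a p q
        hAB.natDegree_denom_le hAB.coeff_zero] at h2
      exact eq_neg_of_add_eq_zero_right h2
    rw [denomVec, ← h1, Matrix.mulVec_mulVec, Matrix.nonsing_inv_mul _ (isUnit_iff_ne_zero.2 h),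
      Matrix.one_mulVec]
  have hB : B = padeDenom a p q := by
    ext k
    rcases Nat.eq_zero_or_pos k with rfl | hk
    · rw [hAB.coeff_zero, coeff_padeDenom_zero]
    by_cases hkq : k ≤ q
    · have h3 := congrFun hv ⟨q - k, by omega⟩
      have h4 := coeff_padeDenom_sub a p q ⟨q - k, by omega⟩
      simp only [Nat.sub_sub_self hkq] at h3 h4
      rw [h3, h4]
    · rw [coeff_eq_zero_of_natDegree_lt, coeff_eq_zero_of_natDegree_lt]
      · exact (natDegree_padeDenom_le a p q).trans_lt (not_le.1 hkq)
      · exact hAB.natDegree_denom_le.trans_lt (not_le.1 hkq)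
  refine ⟨?_, hB⟩
  ext k
  rw [padeNum, PowerSeries.coeff_trunc, ← hB]
  split_ifs with hk
  · have := hdvd k (by omega)
    rw [map_sub, coeff_coe, sub_eq_zero] at this
    exact this.symm
  · exact coeff_eq_zero_of_natDegree_lt (by have := hAB.natDegree_num_le; omega)

theorem padePair_taylor_iff {a : ℂ⟦X⟧} {ζ : ℂ} {p q : ℕ} {A B : ℂ[X]} :
    PadePair a p q (taylor ζ A) (taylor ζ B) ↔ A.natDegree ≤ p ∧ B.natDegree ≤ q ∧
      B.eval ζ = 1 ∧ ∀ v ≤ p + q, PowerSeries.coeff v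
        ((taylor ζ A : ℂ⟦X⟧) * (taylor ζ B : ℂ⟦X⟧)⁻¹) = PowerSeries.coeff v a := by
  have key : B.eval ζ = 1 → ((PowerSeries.X : ℂ⟦X⟧) ^ (p + q + 1) ∣
      a * (taylor ζ B : ℂ[X]) - (taylor ζ A : ℂ[X]) ↔ ∀ v ≤ p + q, PowerSeries.coeff v
        ((taylor ζ A : ℂ⟦X⟧) * (taylor ζ B : ℂ⟦X⟧)⁻¹) = PowerSeries.coeff v a) := by
    intro h1
    have hc : PowerSeries.constantCoeff (taylor ζ B : ℂ⟦X⟧) ≠ 0 := by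
      rw [constantCoeff_coe, taylor_coeff_zero, h1]; exact one_ne_zero
    have hinv := PowerSeries.mul_inv_cancel _ hc
    have h2 : (∀ v ≤ p + q, PowerSeries.coeff v
        ((taylor ζ A : ℂ⟦X⟧) * (taylor ζ B : ℂ⟦X⟧)⁻¹) = PowerSeries.coeff v a) ↔
        (PowerSeries.X : ℂ⟦X⟧) ^ (p + q + 1) ∣
          (taylor ζ A : ℂ⟦X⟧) * (taylor ζ B : ℂ⟦X⟧)⁻¹ - a := by
      simp only [PowerSeries.X_pow_dvd_iff, map_sub, sub_eq_zero, Nat.lt_succ_iff]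
    rw [h2]
    constructor
    · rintro ⟨c, hc⟩
      exact ⟨-(c * (taylor ζ B : ℂ⟦X⟧)⁻¹), by
        linear_combination (-(taylor ζ B : ℂ⟦X⟧)⁻¹) * hc + a * hinv⟩
    · rintro ⟨c, hc⟩
      exact ⟨-(c * (taylor ζ B : ℂ⟦X⟧)), by
        linear_combination (-(taylor ζ B : ℂ⟦X⟧)) * hc + (taylor ζ A : ℂ⟦X⟧) * hinv⟩
  constructor
  · rintro ⟨hA, hB, h0, hd⟩
    rw [taylor_coeff_zero] at h0
    exact ⟨by simpa using hA, by simpa using hB, h0, (key h0).1 hd⟩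
  · rintro ⟨hA, hB, h0, hd⟩
    exact ⟨by simpa using hA, by simpa using hB, by rw [taylor_coeff_zero, h0], (key h0).2 hd⟩

theorem isPade_iff {a : ℂ⟦X⟧} {ζ : ℂ} {p q : ℕ} {Φ : RatFunc ℂ} :
    IsPade a ζ p q Φ ↔ ∃ A B : ℂ[X], PadePair a p q (taylor ζ A) (taylor ζ B) ∧
      Φ = algebraMap ℂ[X] (RatFunc ℂ) A / algebraMap ℂ[X] (RatFunc ℂ) B := by
  simp only [IsPade, padePair_taylor_iff]
  constructor
  · rintro ⟨A, B, h1, h2, h3, h4, h5⟩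
    exact ⟨A, B, ⟨h1, h2, h3, h5⟩, h4⟩
  · rintro ⟨A, B, ⟨h1, h2, h3, h5⟩, h4⟩
    exact ⟨A, B, h1, h2, h3, h4, h5⟩

theorem exists_isPade_of_inD {a : ℂ⟦X⟧} {p q : ℕ} (h : InD a p q) (ζ : ℂ) :
    ∃ Φ, IsPade a ζ p q Φ := by
  refine ⟨_, isPade_iff.2 ⟨taylor (-ζ) (padeNum a p q), taylor (-ζ) (padeDenom a p q), ?_, rfl⟩⟩
  simpa [taylor_taylor] using padePair_padeNum_padeDenom h

theorem pade_eq_of_inD {a : ℂ⟦X⟧} {p q : ℕ} (h : InD a p q) (ζ : ℂ) :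
    ∃ A B : ℂ[X], PadePair a p q (taylor ζ A) (taylor ζ B) ∧
      taylor ζ A = padeNum a p q ∧ taylor ζ B = padeDenom a p q ∧
      pade a ζ p q = algebraMap ℂ[X] (RatFunc ℂ) A / algebraMap ℂ[X] (RatFunc ℂ) B := by
  have hex := exists_isPade_of_inD h ζ
  obtain ⟨A, B, hAB, hΦ⟩ := isPade_iff.1 hex.choose_spec
  have := hAB.eq_of_inD h
  exact ⟨A, B, hAB, this.1, this.2, by rw [pade, dif_pos hex, hΦ]⟩

/-- In `𝔇_{p,q}` numerator and denominator of a Padé pair have no common factor. -/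
theorem PadePair.natDegree_eq_zero_of_mul {a : ℂ⟦X⟧} {p q : ℕ} (h : InD a p q) {A B D : ℂ[X]}
    (hAB : PadePair a p q (A * D) (B * D)) : D.natDegree = 0 := by
  by_contra hD
  have hB0 : B.coeff 0 * D.coeff 0 = 1 := by rw [← mul_coeff_zero, hAB.coeff_zero]
  have hD0 : D.coeff 0 ≠ 0 := right_ne_zero_of_mul_eq_one hB0
  have hDne : D ≠ 0 := fun h => hD0 (by simp [h])
  have hBne : B ≠ 0 := fun h => left_ne_zero_of_mul_eq_one hB0 (by simp [h])
  have hcong : (PowerSeries.X : ℂ⟦X⟧) ^ (p + q + 1) ∣ a * B - A := by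
    have hinv := PowerSeries.mul_inv_cancel (D : ℂ⟦X⟧) (by rwa [constantCoeff_coe])
    obtain ⟨c, hc⟩ := hAB.dvd
    push_cast at hc
    exact ⟨c * (D : ℂ⟦X⟧)⁻¹, by linear_combination (D : ℂ⟦X⟧)⁻¹ * hc - (a * B - A) * hinv⟩
  have hAd : A.natDegree + 1 ≤ p ∨ A = 0 := by
    by_cases hA : A = 0
    · exact Or.inr hA
    · have := hAB.natDegree_num_le
      rw [natDegree_mul hA hDne] at this
      left; omega
  have hBd : B.natDegree + 1 ≤ q := by
    have := hAB.natDegree_denom_le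
    rw [natDegree_mul hBne hDne] at this
    omega
  -- A non-constant D leaves room in both degrees, so any l of degree at most 1 with the same
  -- constant term could replace it. Two choices of l contradict uniqueness.
  have hpair : ∀ l : ℂ[X], l.natDegree ≤ 1 → l.coeff 0 = D.coeff 0 →
      PadePair a p q (A * l) (B * l) := fun l hl hl0 => by
    refine ⟨?_, natDegree_mul_le.trans (by omega), by rw [mul_coeff_zero, hl0, hB0], ?_⟩
    · rcases hAd with hA | hA
      · exact natDegree_mul_le.trans (by omega)
      · simp [hA]
    · push_cast
      rw [← mul_assoc, ← sub_mul]
      exact hcong.mul_right _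
  have h1 := ((hpair (C (D.coeff 0)) (by simp) (by simp)).eq_of_inD h).2
  have h2 := ((hpair (C (D.coeff 0) + X) (by
    refine (natDegree_add_le _ _).trans (by simp)) (by simp)).eq_of_inD h).2
  rw [← h1, mul_add] at h2
  have : B * X = 0 := by simpa using h2
  exact hBne (by simpa using this)

/-- Poles are read off the reduced denominator, whereas continuity is known for `padeNum` and
`padeDenom`. The absence of a common factor makes the two fractions agree up to a constant. -/
theorem ratDist_pade_of_inD {a : ℂ⟦X⟧} {p q : ℕ} (h : InD a p q) (ζ z w : ℂ) :
    ratDist (pade a ζ p q) z w = if (padeDenom a p q).eval (z - ζ) = 0 then ⊤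
      else ‖(padeNum a p q).eval (z - ζ) / (padeDenom a p q).eval (z - ζ) - w‖ₑ := by
  obtain ⟨A, B, hAB, hA, hB, hΦ⟩ := pade_eq_of_inD h ζ
  set Φ := pade a ζ p q
  have hBne : B ≠ 0 := by
    rintro rfl
    simpa using hAB.coeff_zero
  rw [← hA, ← hB, taylor_eval, taylor_eval, sub_add_cancel]
  have hcross : Φ.num * B = A * Φ.denom := by
    refine (RatFunc.num_mul_eq_mul_denom_iff hBne).2 hΦ
  obtain ⟨D, hD⟩ : Φ.denom ∣ B := by rw [hΦ]; exact RatFunc.denom_div_dvd A B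
  have hAD : A = Φ.num * D := by
    refine mul_right_cancel₀ Φ.denom_ne_zero ?_
    rw [← hcross, hD]; ring
  have hDdeg : D.natDegree = 0 := by
    rw [hD, hAD, taylor_mul, taylor_mul] at hAB
    simpa using hAB.natDegree_eq_zero_of_mul h
  obtain ⟨c, rfl⟩ := natDegree_eq_zero.1 hDdeg
  have hc : c ≠ 0 := by
    rintro rfl
    exact hBne (by simpa using hD)
  have e1 : A.eval z = Φ.num.eval z * c := by rw [hAD]; simp
  have e2 : B.eval z = Φ.denom.eval z * c := by
    conv_lhs => rw [hD]
    simp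
  rw [ratDist, e1, e2]
  simp only [mul_eq_zero, hc, or_false]
  split_ifs with h0
  · rfl
  · rw [mul_div_mul_right _ _ hc]
    simp only [RatFunc.eval, eval₂_id]

/-- The Hankel matrix is triangular about its antidiagonal: entries with i + j = q - 1 are the
leading coefficient, those with i + j ≥ q are zero. The kernel is killed entry by entry, starting
from the last row. -/
theorem inD_of_natDegree_eq {c : ℂ[X]} {p : ℕ} (hc : c ≠ 0) (hp : c.natDegree = p) (q : ℕ) :
    InD (c : ℂ⟦X⟧) p q := by
  intro hdet
  obtain ⟨v, hv, hmul⟩ := Matrix.exists_mulVec_eq_zero_iff.2 hdet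
  refine hv (funext fun j => ?_)
  have key : ∀ k : ℕ, ∀ hk : k < q, v ⟨k, hk⟩ = 0 := by
    intro k
    induction k using Nat.strong_induction_on with
    | _ k ih =>
      intro hk
      have h1 := congrFun hmul ⟨q - 1 - k, by omega⟩
      rw [Matrix.mulVec, dotProduct, Finset.sum_eq_single ⟨k, hk⟩] at h1
      · rw [hankel, Matrix.of_apply, if_neg (by simp only; omega), coeff_coe] at h1
        simp only at h1
        rw [show p + 1 + (q - 1 - k) + k - q = c.natDegree by omega] at h1
        simpa [hc] using h1
      · intro j _ hj
        rcases lt_or_gt_of_ne (fun h => hj (Fin.ext h) : (j : ℕ) ≠ k) with hlt | hgt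
        · rw [ih j hlt j.2, mul_zero]
        · rw [hankel, Matrix.of_apply, if_neg (by simp only; omega), coeff_coe,
            coeff_eq_zero_of_natDegree_lt (by simp only; omega), zero_mul]
      · simp
  exact key j j.2

theorem padePair_self {c : ℂ[X]} {p : ℕ} (hp : c.natDegree = p) (q : ℕ) :
    PadePair (c : ℂ⟦X⟧) p q c 1 :=
  ⟨hp.le, by simp, by simp, by simp⟩

theorem ratDist_pade_of_natDegree_eq {P : ℂ[X]} {p : ℕ} (hP : P ≠ 0) (hp : P.natDegree = p)
    (q : ℕ) (ζ z w : ℂ) :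
    ratDist (pade (taylor ζ P : ℂ[X]) ζ p q) z w = ‖P.eval z - w‖ₑ := by
  have hc : taylor ζ P ≠ 0 := by rwa [Ne, taylor_eq_zero]
  have hd : (taylor ζ P).natDegree = p := by rwa [natDegree_taylor]
  have hD := inD_of_natDegree_eq hc hd q
  obtain ⟨h1, h2⟩ := (padePair_self hd q).eq_of_inD hD
  rw [ratDist_pade_of_inD hD, ← h1, ← h2]
  simp [taylor_eval]

end UniversalPade

/-! ### The space of holomorphic functions -/

namespace UniversalPade

variable {Ω : Set ℂ}

theorem extendZero_apply (g : C(Ω, ℂ)) {z : ℂ} (hz : z ∈ Ω) : extendZero g z = g ⟨z, hz⟩ := by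
  rw [extendZero]
  exact Subtype.val_injective.extend_apply (fun z : Ω => g z) 0 ⟨z, hz⟩

theorem Hol.differentiableOn (f : Hol Ω) : DifferentiableOn ℂ f.toFun Ω := f.2

theorem tendstoLocallyUniformlyOn_extendZero (hΩ : IsOpen Ω) {ι : Type*} {l : Filter ι}
    {F : ι → C(Ω, ℂ)} {g : C(Ω, ℂ)} (h : Tendsto F l (𝓝 g)) :
    TendstoLocallyUniformlyOn (fun i => extendZero (F i)) (extendZero g) l Ω := by
  have : LocallyCompactSpace Ω := hΩ.locallyCompactSpace
  rw [tendstoLocallyUniformlyOn_iff_tendstoLocallyUniformly_comp_coe]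
  have h2 := ContinuousMap.tendsto_iff_tendstoLocallyUniformly.1 h
  have e : ∀ (g : C(Ω, ℂ)) (z : Ω), extendZero g z = g z := fun g z => extendZero_apply g z.2
  simpa only [Function.comp_def, e] using h2

theorem isClosed_setOf_differentiableOn (hΩ : IsOpen Ω) :
    IsClosed {g : C(Ω, ℂ) | DifferentiableOn ℂ (extendZero g) Ω} := by
  refine isClosed_iff_forall_filter.2 fun g l hl hls hlg => ?_
  exact (tendstoLocallyUniformlyOn_extendZero hΩ (F := id) hlg).differentiableOn
    (le_principal_iff.1 hls) hΩ

/-- By Weierstrass' theorem the holomorphic functions are closed in C(Ω), which is completely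
metrizable. -/
theorem baireSpace_hol (hΩ : IsOpen Ω) : BaireSpace (Hol Ω) := by
  have : LocallyCompactSpace Ω := hΩ.locallyCompactSpace
  have : TopologicalSpace.IsCompletelyPseudoMetrizableSpace (Hol Ω) :=
    (isClosed_setOf_differentiableOn hΩ).isCompletelyPseudoMetrizableSpace
  infer_instance

theorem differentiableOn_iteratedDeriv (hΩ : IsOpen Ω) {f : ℂ → ℂ} (hf : DifferentiableOn ℂ f Ω)
    (v : ℕ) : DifferentiableOn ℂ (iteratedDeriv v f) Ω := by
  induction v with
  | zero => simpa using hf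
  | succ v ih =>
    rw [iteratedDeriv_succ]
    exact ih.deriv hΩ

theorem tendstoLocallyUniformlyOn_iteratedDeriv (hΩ : IsOpen Ω) (f : Hol Ω) (v : ℕ) :
    TendstoLocallyUniformlyOn (fun g : Hol Ω => iteratedDeriv v g.toFun)
      (iteratedDeriv v f.toFun) (𝓝 f) Ω := by
  induction v with
  | zero =>
    simp only [iteratedDeriv_zero]
    exact tendstoLocallyUniformlyOn_extendZero hΩ continuous_subtype_val.continuousAt
  | succ v ih =>
    simp only [iteratedDeriv_succ]
    exact ih.deriv (Eventually.of_forall fun g =>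
      differentiableOn_iteratedDeriv hΩ g.differentiableOn v) hΩ

/-- Continuity is needed jointly in function and centre, so that compactness can later make
neighbourhoods of f uniform in ζ. -/
theorem continuousAt_iteratedDeriv (hΩ : IsOpen Ω) (f : Hol Ω) {ζ : ℂ} (hζ : ζ ∈ Ω) (v : ℕ) :
    ContinuousAt (fun x : Hol Ω × ℂ => iteratedDeriv v x.1.toFun x.2) (f, ζ) := by
  have hc : ContinuousAt (iteratedDeriv v f.toFun) ζ :=
    (differentiableOn_iteratedDeriv hΩ f.differentiableOn v).continuousOn.continuousAt
      (hΩ.mem_nhds hζ)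
  rw [Metric.continuousAt_iff']
  intro ε hε
  obtain ⟨t, ht, h⟩ := Metric.tendstoLocallyUniformlyOn_iff.1
    (tendstoLocallyUniformlyOn_iteratedDeriv hΩ f v) (ε / 2) (half_pos hε) ζ hζ
  rw [hΩ.nhdsWithin_eq hζ] at ht
  rw [nhds_prod_eq]
  filter_upwards [h.prod_mk ((Metric.continuousAt_iff'.1 hc (ε / 2) (half_pos hε)).and ht)]
    with x hx
  have h1 := hx.1 x.2 hx.2.2
  have h2 := hx.2.1
  rw [dist_comm] at h1
  exact (dist_triangle _ _ _).trans_lt (by linarith)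

theorem continuousAt_coeff_taylorSeries (hΩ : IsOpen Ω) (f : Hol Ω) {ζ : ℂ} (hζ : ζ ∈ Ω) (v : ℕ) :
    ContinuousAt (fun x : Hol Ω × ℂ => PowerSeries.coeff v (taylorSeries x.1.toFun x.2))
      (f, ζ) := by
  simp only [taylorSeries, PowerSeries.coeff_mk]
  exact (continuousAt_iteratedDeriv hΩ f hζ v).div_const _

/-- A polynomial as a holomorphic function. -/
def polyHol (Ω : Set ℂ) (P : ℂ[X]) : Hol Ω :=
  ⟨⟨fun z => P.eval (z : ℂ), by fun_prop⟩,
    P.differentiable.differentiableOn.congr fun z hz => by rw [extendZero_apply _ hz]; rfl⟩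

theorem polyHol_toFun {P : ℂ[X]} {z : ℂ} (hz : z ∈ Ω) : (polyHol Ω P).toFun z = P.eval z := by
  rw [Hol.toFun, extendZero_apply _ hz]; rfl

theorem iteratedDeriv_eval (P : ℂ[X]) (v : ℕ) :
    iteratedDeriv v (fun z => P.eval z) = fun z => (derivative^[v] P).eval z := by
  induction v with
  | zero => simp
  | succ v ih =>
    rw [iteratedDeriv_succ, ih, Function.iterate_succ_apply']
    funext z
    exact (derivative^[v] P).deriv

theorem taylorSeries_polyHol (hΩ : IsOpen Ω) (P : ℂ[X]) {ζ : ℂ} (hζ : ζ ∈ Ω) :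
    taylorSeries (polyHol Ω P).toFun ζ = (taylor ζ P : ℂ[X]) := by
  ext v
  have h1 : (polyHol Ω P).toFun =ᶠ[𝓝 ζ] fun z => P.eval z := by
    filter_upwards [hΩ.mem_nhds hζ] with z hz using polyHol_toFun hz
  rw [taylorSeries, PowerSeries.coeff_mk, h1.iteratedDeriv_eq, iteratedDeriv_eval, coeff_coe,
    taylor_coeff, ← factorial_smul_hasseDeriv]
  simp [Nat.factorial_ne_zero]

theorem exists_compact_forall_norm_sub_lt {O : Set (Hol Ω)} (hO : IsOpen O) {f : Hol Ω}
    (hf : f ∈ O) : ∃ L : Set ℂ, IsCompact L ∧ L ⊆ Ω ∧ ∃ δ > 0, ∀ g : Hol Ω,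
      (∀ z ∈ L, ‖g.toFun z - f.toFun z‖ < δ) → g ∈ O := by
  obtain ⟨O', hO', rfl⟩ := isOpen_induced_iff.1 hO
  obtain ⟨⟨K, δ⟩, ⟨hK, hδ⟩, h⟩ := (nhds_basis_uniformity
    (Metric.uniformity_basis_dist.compactConvergenceUniformity (α := Ω) (β := ℂ))).mem_iff.1
    (hO'.mem_nhds hf)
  refine ⟨Subtype.val '' K, hK.image continuous_subtype_val, by simp, δ, hδ, fun g hg => h ?_⟩
  intro z hz
  have := hg z ⟨z, hz, rfl⟩
  rwa [Hol.toFun, Hol.toFun, extendZero_apply _ z.2, extendZero_apply _ z.2, ← dist_eq_norm] at this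

end UniversalPade

/-! ### Continuity of Padé approximants; openness and density of the good sets -/

namespace UniversalPade

section Continuity

variable {Y : Type*} [TopologicalSpace Y] {a : Y → ℂ⟦X⟧} {p q : ℕ} {y₀ : Y}

theorem continuousAt_hankel (ha : ∀ v, ContinuousAt (fun y => PowerSeries.coeff v (a y)) y₀) :
    ContinuousAt (fun y => hankel (a y) p q) y₀ := by
  refine continuousAt_pi.2 fun i => continuousAt_pi.2 fun j => ?_
  simp only [hankel, Matrix.of_apply]
  split_ifs
  · exact continuousAt_const
  · exact ha _

theorem eventually_inD (ha : ∀ v, ContinuousAt (fun y => PowerSeries.coeff v (a y)) y₀)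
    (h : InD (a y₀) p q) : ∀ᶠ y in 𝓝 y₀, InD (a y) p q :=
  ((continuous_id.matrix_det (A := fun M : Matrix (Fin q) (Fin q) ℂ => M)).continuousAt.comp
    (continuousAt_hankel ha)).eventually_ne h

theorem continuousAt_denomVec (ha : ∀ v, ContinuousAt (fun y => PowerSeries.coeff v (a y)) y₀)
    (h : InD (a y₀) p q) : ContinuousAt (fun y => denomVec (a y) p q) y₀ := by
  have hinv : ContinuousAt (fun y => (hankel (a y) p q)⁻¹) y₀ := by
    refine (continuousAt_matrix_inv _ ?_).comp (continuousAt_hankel ha)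
    rw [Ring.inverse_eq_inv']
    exact continuousAt_inv₀ h
  refine continuousAt_pi.2 fun i => ?_
  simp only [denomVec, Matrix.mulVec, dotProduct]
  refine tendsto_finsetSum _ fun j _ => ?_
  exact (continuousAt_pi.1 (continuousAt_pi.1 hinv i) j).mul (ha _).neg

theorem continuousAt_coeff_padeDenom
    (ha : ∀ v, ContinuousAt (fun y => PowerSeries.coeff v (a y)) y₀) (h : InD (a y₀) p q) (k : ℕ) :
    ContinuousAt (fun y => (padeDenom (a y) p q).coeff k) y₀ := by
  simp only [padeDenom, coeff_add, finsetSum_coeff, coeff_C_mul]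
  refine continuousAt_const.add (tendsto_finsetSum _ fun j _ => ?_)
  exact (continuousAt_pi.1 (continuousAt_denomVec ha h) j).mul continuousAt_const

theorem continuousAt_eval_padeDenom
    (ha : ∀ v, ContinuousAt (fun y => PowerSeries.coeff v (a y)) y₀) (h : InD (a y₀) p q)
    {u : Y → ℂ} (hu : ContinuousAt u y₀) :
    ContinuousAt (fun y => (padeDenom (a y) p q).eval (u y)) y₀ := by
  have : ∀ y, (padeDenom (a y) p q).eval (u y) =
      ∑ k ∈ Finset.range (q + 1), (padeDenom (a y) p q).coeff k * u y ^ k := fun y =>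
    eval_eq_sum_range' (Nat.lt_succ_iff.2 (natDegree_padeDenom_le _ _ _)) _
  simp only [this]
  exact tendsto_finsetSum _ fun k _ => (continuousAt_coeff_padeDenom ha h k).mul (hu.pow k)

theorem continuousAt_eval_padeNum
    (ha : ∀ v, ContinuousAt (fun y => PowerSeries.coeff v (a y)) y₀) (h : InD (a y₀) p q)
    {u : Y → ℂ} (hu : ContinuousAt u y₀) :
    ContinuousAt (fun y => (padeNum (a y) p q).eval (u y)) y₀ := by
  have : ∀ y, (padeNum (a y) p q).eval (u y) = ∑ k ∈ Finset.range (p + 1),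
      (∑ x ∈ Finset.HasAntidiagonal.antidiagonal k, PowerSeries.coeff x.1 (a y) *
        (padeDenom (a y) p q).coeff x.2) * u y ^ k := fun y => by
    rw [padeNum, eval_eq_sum_range' (PowerSeries.natDegree_trunc_lt _ _)]
    refine Finset.sum_congr rfl fun k hk => ?_
    rw [PowerSeries.coeff_trunc, if_pos (Finset.mem_range.1 hk), PowerSeries.coeff_mul]
    simp only [coeff_coe]
  simp only [this]
  refine tendsto_finsetSum _ fun k _ => ContinuousAt.mul (tendsto_finsetSum _ fun x _ => ?_)
    (hu.pow k)
  exact (ha _).mul (continuousAt_coeff_padeDenom ha h _)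

theorem eventually_ratDist_pade_lt
    (ha : ∀ v, ContinuousAt (fun y => PowerSeries.coeff v (a y)) y₀) {ζ z w : Y → ℂ}
    (hζ : ContinuousAt ζ y₀) (hz : ContinuousAt z y₀) (hw : ContinuousAt w y₀) {ε : ℝ≥0∞}
    (h : InD (a y₀) p q) (hlt : ratDist (pade (a y₀) (ζ y₀) p q) (z y₀) (w y₀) < ε) :
    ∀ᶠ y in 𝓝 y₀, ratDist (pade (a y) (ζ y) p q) (z y) (w y) < ε := by
  rw [ratDist_pade_of_inD h] at hlt
  -- A value below ε is finite, so there is no pole at the base point.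
  have h0 : (padeDenom (a y₀) p q).eval (z y₀ - ζ y₀) ≠ 0 := fun h0 => by
    rw [if_pos h0] at hlt
    exact not_top_lt hlt
  rw [if_neg h0] at hlt
  have hD := continuousAt_eval_padeDenom ha h (hz.sub hζ)
  have hN := continuousAt_eval_padeNum ha h (hz.sub hζ)
  filter_upwards [eventually_inD ha h, hD.eventually_ne h0,
    (((hN.div hD h0).sub hw).enorm).eventually_lt continuousAt_const hlt] with y h1 h2 h3
  rw [ratDist_pade_of_inD h1]
  exact (if_neg h2).trans_lt h3

end Continuity

variable {Ω : Set ℂ}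

/-- The functions with a `[p/q]` Padé approximant for centres in `L`, `(p, q) ∈ 𝔉`, that is
`ε`-close to `h` on `K` and to the function on `L`. -/
def goodSet (𝔉 : Set (ℕ × ℕ)) (Ω K L : Set ℂ) (h : ℂ[X]) (ε : ℝ≥0∞) : Set (Hol Ω) :=
  {f | ∃ s ∈ 𝔉, ∀ ζ ∈ L, InD (taylorSeries f.toFun ζ) s.1 s.2 ∧
    (∀ z ∈ K, ratDist (pade (taylorSeries f.toFun ζ) ζ s.1 s.2) z (h.eval z) < ε) ∧
    ∀ z ∈ L, ratDist (pade (taylorSeries f.toFun ζ) ζ s.1 s.2) z (f.toFun z) < ε}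

/-- With the pair from 𝔉 fixed, all conditions are pointwise and open jointly in (f, ζ, z); the tube
lemma over the compact sets L, L × K and L × L does the rest. -/
theorem isOpen_goodSet (hΩ : IsOpen Ω) {𝔉 : Set (ℕ × ℕ)} {K L : Set ℂ} (hK : IsCompact K)
    (hL : IsCompact L) (hLΩ : L ⊆ Ω) (h : ℂ[X]) (ε : ℝ≥0∞) :
    IsOpen (goodSet 𝔉 Ω K L h ε) := by
  refine isOpen_iff_mem_nhds.2 fun f hf => ?_
  obtain ⟨s, hs, hf⟩ := hf
  have hc : ∀ ζ ∈ L, ∀ z : ℂ, ∀ v, ContinuousAt (fun y : Hol Ω × ℂ × ℂ =>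
      PowerSeries.coeff v (taylorSeries y.1.toFun y.2.1)) (f, ζ, z) := fun ζ hζ z v =>
    (continuousAt_coeff_taylorSeries hΩ f (hLΩ hζ) v).comp₂_of_eq continuousAt_fst
      (continuousAt_fst.comp continuousAt_snd) rfl
  have h1 : ∀ᶠ g : Hol Ω in 𝓝 f, ∀ ζ ∈ L, InD (taylorSeries g.toFun ζ) s.1 s.2 :=
    hL.eventually_forall_of_forall_eventually fun ζ hζ =>
      eventually_inD (a := fun y : Hol Ω × ℂ => taylorSeries y.1.toFun y.2)
        (continuousAt_coeff_taylorSeries hΩ f (hLΩ hζ)) (hf ζ hζ).1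
  have h2 : ∀ᶠ g : Hol Ω in 𝓝 f, ∀ x ∈ L ×ˢ K,
      ratDist (pade (taylorSeries g.toFun x.1) x.1 s.1 s.2) x.2 (h.eval x.2) < ε :=
    (hL.prod hK).eventually_forall_of_forall_eventually fun x hx =>
      eventually_ratDist_pade_lt (a := fun y : Hol Ω × ℂ × ℂ => taylorSeries y.1.toFun y.2.1)
        (ζ := fun y => y.2.1) (z := fun y => y.2.2) (w := fun y => h.eval y.2.2)
        (hc x.1 hx.1 x.2) (by fun_prop) (by fun_prop) (by fun_prop)
        (hf x.1 hx.1).1 ((hf x.1 hx.1).2.1 x.2 hx.2)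
  have h3 : ∀ᶠ g : Hol Ω in 𝓝 f, ∀ x ∈ L ×ˢ L,
      ratDist (pade (taylorSeries g.toFun x.1) x.1 s.1 s.2) x.2 (g.toFun x.2) < ε :=
    (hL.prod hL).eventually_forall_of_forall_eventually fun x hx =>
      eventually_ratDist_pade_lt (a := fun y : Hol Ω × ℂ × ℂ => taylorSeries y.1.toFun y.2.1)
        (ζ := fun y => y.2.1) (z := fun y => y.2.2) (w := fun y => y.1.toFun y.2.2)
        (hc x.1 hx.1 x.2) (by fun_prop) (by fun_prop) (by
          have := continuousAt_iteratedDeriv hΩ f (hLΩ hx.2) 0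
          simp only [iteratedDeriv_zero] at this
          exact this.comp₂_of_eq continuousAt_fst (continuousAt_snd.comp continuousAt_snd) rfl)
        (hf x.1 hx.1).1 ((hf x.1 hx.1).2.2 x.2 hx.2)
  filter_upwards [h1, h2, h3] with g g1 g2 g3
  exact ⟨s, hs, fun ζ hζ => ⟨g1 ζ hζ, fun z hz => g2 (ζ, z) ⟨hζ, hz⟩,
    fun z hz => g3 (ζ, z) ⟨hζ, hz⟩⟩⟩

theorem dense_goodSet {𝔉 : Set (ℕ × ℕ)}
    (h𝔉 : ∃ s : ℕ → ℕ × ℕ, (∀ n, s n ∈ 𝔉) ∧ Tendsto (fun n => (s n).1) atTop atTop)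
    (hΩo : IsOpen Ω) (hΩ : IsSimplyConnected Ω) {K L : Set ℂ} (hK : IsCompact K) (hKΩ : K ⊆ Ωᶜ)
    (hKc : IsPreconnected Kᶜ) (hLΩ : L ⊆ Ω) (h : ℂ[X]) {ε : ℝ} (hε : 0 < ε) :
    Dense (goodSet 𝔉 Ω K L h (ENNReal.ofReal ε)) := by
  refine dense_iff_inter_open.2 fun O hO ⟨f, hf⟩ => ?_
  obtain ⟨M, hM, hMΩ, δ, hδ, hMO⟩ := exists_compact_forall_norm_sub_lt hO hf
  -- Half is spent on approximating by P, half on the perturbation of P.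
  set η := min ε δ / 2 with hη
  have hηpos : 0 < η := half_pos (lt_min hε hδ)
  obtain ⟨P, hPf, hPh⟩ := exists_polynomial_near_near hΩo hΩ hM hMΩ hK hKΩ hKc
    f.differentiableOn h hηpos
  obtain ⟨s, hs, hst⟩ := h𝔉
  obtain ⟨n, hn⟩ := (hst.eventually_gt_atTop P.natDegree).exists
  set p := (s n).1 with hp
  obtain ⟨R, hR, hRs⟩ := (hM.union hK).isBounded.subset_closedBall_lt 0 0
  -- Chosen so that |d z^p| ≤ η on M ∪ K; since p > deg P, the perturbed polynomial has degree
  -- exactly p.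
  set d : ℝ := η / R ^ p with hd
  have hdpos : 0 < d := by positivity
  set Q : ℂ[X] := P + C (d : ℂ) * X ^ p with hQ
  have hdC : (d : ℂ) ≠ 0 := Complex.ofReal_ne_zero.2 hdpos.ne'
  have hQd : Q.natDegree = p := by
    rw [hQ, natDegree_add_eq_right_of_natDegree_lt, natDegree_C_mul_X_pow _ _ hdC]
    rwa [natDegree_C_mul_X_pow _ _ hdC]
  have hQ0 : Q ≠ 0 := by
    intro h0
    have : Q.coeff p = 0 := by simp [h0]
    rw [hQ, coeff_add, coeff_eq_zero_of_natDegree_lt hn] at this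
    simp [hdC] at this
  have hQP : ∀ z ∈ M ∪ K, ‖Q.eval z - P.eval z‖ ≤ η := fun z hz => by
    have hzR : ‖z‖ ≤ R := by simpa using hRs hz
    have : Q.eval z - P.eval z = d * z ^ p := by simp [hQ]
    rw [this, norm_mul, norm_pow, Complex.norm_real, Real.norm_of_nonneg hdpos.le]
    calc d * ‖z‖ ^ p ≤ d * R ^ p := by gcongr
      _ = η := by rw [hd]; field_simp
  have hηε : η + η ≤ ε := by rw [hη, add_halves]; exact min_le_left _ _
  have hηδ : η + η ≤ δ := by rw [hη, add_halves]; exact min_le_right _ _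
  have htri : ∀ z w : ℂ, ‖Q.eval z - w‖ ≤ ‖Q.eval z - P.eval z‖ + ‖P.eval z - w‖ := fun z w => by
    simpa using norm_add_le (Q.eval z - P.eval z) (P.eval z - w)
  refine ⟨polyHol Ω Q, hMO _ fun z hz => ?_, s n, hs n, fun ζ hζ => ?_⟩
  · rw [polyHol_toFun (hMΩ hz)]
    linarith [htri z (f.toFun z), hQP z (Or.inl hz), hPf z hz]
  rw [taylorSeries_polyHol hΩo Q (hLΩ hζ)]
  refine ⟨inD_of_natDegree_eq (by rwa [Ne, taylor_eq_zero]) (by rwa [natDegree_taylor]) _,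
    fun z hz => ?_, fun z hz => ?_⟩
  · rw [ratDist_pade_of_natDegree_eq hQ0 hQd, ← ofReal_norm,
      ENNReal.ofReal_lt_ofReal_iff hε]
    linarith [htri z (h.eval z), hQP z (Or.inr hz), hPh z hz]
  -- The approximant is the function itself, so the error on L is zero and L need not be related to
  -- M.
  · rw [ratDist_pade_of_natDegree_eq hQ0 hQd, polyHol_toFun (hLΩ hz), sub_self, enorm_zero]
    exact ENNReal.ofReal_pos.2 hε

end UniversalPade

/-! ### Reduction to countably many conditions -/

namespace UniversalPade

theorem exists_nat_forall_subset_innerCompact {Ω L : Set ℂ} (hΩo : IsOpen Ω) (hL : IsCompact L)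
    (hLΩ : L ⊆ Ω) : ∃ N : ℕ, ∀ n : ℕ, N ≤ n → L ⊆ innerCompact Ω n (1 / (n + 1)) := by
  obtain ⟨R, δ, hδ, h⟩ := exists_subset_innerCompact hΩo hL hLΩ
  obtain ⟨N₁, h₁⟩ := exists_nat_ge R
  obtain ⟨N₂, h₂⟩ := exists_nat_one_div_lt hδ
  refine ⟨max N₁ N₂, fun n hn z hz => ⟨?_, fun a ha => ?_⟩⟩
  · exact (h hz).1.trans (h₁.trans (Nat.cast_le.2 ((le_max_left _ _).trans hn)))
  · refine le_trans (le_trans ?_ h₂.le) ((h hz).2 a ha)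
    exact Nat.one_div_le_one_div ((le_max_right _ _).trans hn)

theorem isConnected_setOf_lt_norm (R : ℝ) : IsConnected {z : ℂ | R < ‖z‖} := by
  have h : {z : ℂ | R < ‖z‖} =
      (fun x : ℝ × ℝ => (x.1 : ℂ) * Complex.exp (x.2 * Complex.I)) '' (Set.Ioi R ×ˢ Set.univ) := by
    ext z
    constructor
    · intro hz
      exact ⟨(‖z‖, z.arg), ⟨hz, trivial⟩, Complex.norm_mul_exp_arg_mul_I z⟩
    · rintro ⟨⟨r, θ⟩, ⟨hr, -⟩, rfl⟩
      have hr' : R < r := hr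
      simp only [Set.mem_ofPred_eq, norm_mul, Complex.norm_real, Complex.norm_exp_ofReal_mul_I,
        mul_one]
      exact hr'.trans_le (le_abs_self r)
  rw [h]
  exact ((isConnected_Ioi).prod isConnected_univ).image _ (by fun_prop)

/-- The complement of `Ω`, of finitely many discs and of a neighbourhood of infinity. -/
def outerCompact (Ω : Set ℂ) (i : Finset (ℕ × ℕ) × ℕ) : Set ℂ :=
  (Ω ∪ (⋃ j ∈ i.1, Metric.ball (TopologicalSpace.denseSeq ℂ j.1) (1 / (j.2 + 1))) ∪
    {z | (i.2 : ℝ) < ‖z‖})ᶜ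

theorem isCompact_outerCompact {Ω : Set ℂ} (hΩ : IsOpen Ω) (i : Finset (ℕ × ℕ) × ℕ) :
    IsCompact (outerCompact Ω i) := by
  refine (isCompact_closedBall (0 : ℂ) i.2).of_isClosed_subset ?_ fun z hz => ?_
  · refine IsOpen.isClosed_compl ?_
    exact (hΩ.union (isOpen_biUnion fun _ _ => Metric.isOpen_ball)).union
      (isOpen_lt continuous_const continuous_norm)
  · by_contra h
    exact hz (Or.inr (by simpa using h))

theorem outerCompact_subset (Ω : Set ℂ) (i : Finset (ℕ × ℕ) × ℕ) : outerCompact Ω i ⊆ Ωᶜ :=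
  Set.compl_subset_compl.2 fun _ hz => Or.inl (Or.inl hz)

theorem exists_denseSeq_ball_subset {U : Set ℂ} (hU : IsOpen U) {x : ℂ} (hx : x ∈ U) :
    ∃ j : ℕ × ℕ, x ∈ Metric.ball (TopologicalSpace.denseSeq ℂ j.1) (1 / (j.2 + 1)) ∧
      Metric.ball (TopologicalSpace.denseSeq ℂ j.1) (1 / (j.2 + 1)) ⊆ U := by
  obtain ⟨ε, hε, hb⟩ := Metric.isOpen_iff.1 hU x hx
  obtain ⟨k, hk⟩ := exists_nat_one_div_lt (half_pos hε)
  obtain ⟨n, hn⟩ := (TopologicalSpace.denseRange_denseSeq ℂ).exists_dist_lt x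
    (ε := 1 / ((k : ℝ) + 1)) (by positivity)
  refine ⟨(n, k), hn, fun y hy => hb ?_⟩
  rw [Metric.mem_ball] at hy ⊢
  rw [dist_comm] at hn
  linarith [dist_triangle y (TopologicalSpace.denseSeq ℂ n) x]

/-- A path off K joins Ω to the region near infinity and is covered by finitely many balls of a
countable family, all missing K. Removing Ω, these balls and the outer region leaves a compact set
containing K; the removed set is connected because every piece meets the path or is linked to it. -/
theorem exists_subset_outerCompact {Ω K : Set ℂ} (hΩ : IsConnected Ω) (hK : IsCompact K)
    (hKΩ : K ⊆ Ωᶜ) (hKc : IsConnected Kᶜ) :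
    ∃ i, K ⊆ outerCompact Ω i ∧ IsConnected (outerCompact Ω i)ᶜ := by
  obtain ⟨R, hR⟩ := hK.isBounded.subset_closedBall 0
  obtain ⟨N, hN⟩ := exists_nat_ge R
  have hKN : ∀ z ∈ K, ‖z‖ ≤ N := fun z hz => by
    have := hR hz
    rw [mem_closedBall_zero_iff] at this
    exact this.trans hN
  obtain ⟨a, ha⟩ := hΩ.nonempty
  have hext := isConnected_setOf_lt_norm N
  obtain ⟨b, hb⟩ := hext.nonempty
  have hKo : IsOpen Kᶜ := hK.isClosed.isOpen_compl
  obtain ⟨γ, hγ⟩ := (hKo.isConnected_iff_isPathConnected.1 hKc).joinedIn a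
    (fun h => hKΩ h ha) b (fun h => not_lt.2 (hKN b h) hb)
  set S : Set ℂ := Set.range γ with hS
  have hSc : IsCompact S := isCompact_range γ.continuous
  have hSp : IsPreconnected S := isPreconnected_range γ.continuous
  have haS : a ∈ S := ⟨0, γ.source⟩
  have hbS : b ∈ S := ⟨1, γ.target⟩
  have hSK : S ⊆ Kᶜ := by rintro _ ⟨t, rfl⟩; exact hγ t
  choose! j hj hjK using fun x (hx : x ∈ Kᶜ) => exists_denseSeq_ball_subset hKo hx
  obtain ⟨t, htS, hSt⟩ := hSc.elim_nhds_subcover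
    (fun x => Metric.ball (TopologicalSpace.denseSeq ℂ (j x).1) (1 / ((j x).2 + 1)))
    fun x hx => Metric.isOpen_ball.mem_nhds (hj x (hSK hx))
  refine ⟨(t.image j, N), fun z hz h => ?_, ?_⟩
  · rcases h with (h | h) | h
    · exact hKΩ hz h
    · simp only [Finset.mem_image, Set.mem_iUnion] at h
      obtain ⟨_, ⟨x, hx, rfl⟩, h⟩ := h
      exact hjK x (hSK (htS x hx)) h hz
    · exact not_lt.2 (hKN z hz) h
  · rw [outerCompact, compl_compl]
    set B := ⋃ i ∈ (t.image j, N).1,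
      Metric.ball (TopologicalSpace.denseSeq ℂ i.1) (1 / (i.2 + 1)) with hB
    have hsub : ∀ x ∈ t,
        Metric.ball (TopologicalSpace.denseSeq ℂ (j x).1) (1 / ((j x).2 + 1)) ⊆ B := fun x hx =>
      Set.subset_biUnion_of_mem
        (u := fun i : ℕ × ℕ => Metric.ball (TopologicalSpace.denseSeq ℂ i.1) (1 / (i.2 + 1)))
        (show j x ∈ (t.image j, N).1 from Finset.mem_image_of_mem _ hx)
    have hSB : S ⊆ B := hSt.trans (Set.iUnion₂_subset hsub)
    refine ⟨⟨a, Or.inl (Or.inl ha)⟩, isPreconnected_of_forall a ?_⟩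
    rintro y ((hy | hy) | hy)
    · exact ⟨Ω, fun z hz => Or.inl (Or.inl hz), ha, hy, hΩ.isPreconnected⟩
    · simp only [hB, Finset.mem_image, Set.mem_iUnion] at hy
      obtain ⟨_, ⟨x, hx, rfl⟩, hy⟩ := hy
      refine ⟨_, ?_, Or.inl haS, Or.inr hy, hSp.union x (htS x hx) (hj x (hSK (htS x hx)))
        (convex_ball _ _).isPreconnected⟩
      exact fun z hz => Or.inl (Or.inr (hz.elim (fun h => hSB h) fun h => hsub x hx h))
    · exact ⟨S ∪ {z | (N : ℝ) < ‖z‖}, fun z hz => hz.elim (fun h => Or.inl (Or.inr (hSB h))) Or.inr,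
        Or.inl haS, Or.inr hy, hSp.union b hbS hb hext.isPreconnected⟩

/-- Countably many of the admissible compact sets are cofinal. -/
theorem exists_seq_compact_cofinal {Ω : Set ℂ} (hΩo : IsOpen Ω) (hΩ : IsConnected Ω) :
    ∃ K : ℕ → Set ℂ, (∀ m, IsCompact (K m) ∧ K m ⊆ Ωᶜ ∧ IsConnected (K m)ᶜ) ∧
      ∀ T : Set ℂ, IsCompact T → T ⊆ Ωᶜ → IsConnected Tᶜ → ∃ m, T ⊆ K m := by
  -- The empty compact set provides an index, as enumerating the index set by ℕ requires it to be
  -- non-empty.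
  obtain ⟨i₀, -, hi₀⟩ := exists_subset_outerCompact hΩ isCompact_empty (Set.empty_subset _)
    (by rw [Set.compl_empty]; exact isConnected_univ)
  have : Nonempty {i // IsConnected (outerCompact Ω i)ᶜ} := ⟨⟨i₀, hi₀⟩⟩
  obtain ⟨e, he⟩ := exists_surjective_nat {i // IsConnected (outerCompact Ω i)ᶜ}
  refine ⟨fun m => outerCompact Ω (e m).1, fun m => ⟨isCompact_outerCompact hΩo _,
    outerCompact_subset Ω _, (e m).2⟩, fun T hT hTΩ hTc => ?_⟩
  obtain ⟨i, hTi, hi⟩ := exists_subset_outerCompact hΩ hT hTΩ hTc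
  obtain ⟨m, hm⟩ := he ⟨i, hi⟩
  exact ⟨m, by simpa only [hm] using hTi⟩

/-- C(K) is a separable metric space, hence so is its subset of polynomial functions. -/
theorem exists_seq_polynomial_dense {K : Set ℂ} (hK : IsCompact K) :
    ∃ D : ℕ → ℂ[X], ∀ (h : ℂ[X]) {ε : ℝ}, 0 < ε → ∃ j, ∀ z ∈ K, ‖(D j).eval z - h.eval z‖ < ε := by
  have : CompactSpace K := isCompact_iff_compactSpace.1 hK
  set φ : ℂ[X] → C(K, ℂ) := fun h => h.toContinuousMapOn K with hφ
  have : Nonempty (Set.range φ) := ⟨⟨_, 0, rfl⟩⟩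
  choose D hD using fun j => (TopologicalSpace.denseSeq (Set.range φ) j).2
  refine ⟨D, fun h ε hε => ?_⟩
  obtain ⟨j, hj⟩ := (TopologicalSpace.denseRange_denseSeq (Set.range φ)).exists_dist_lt
    ⟨φ h, h, rfl⟩ hε
  refine ⟨j, fun z hz => ?_⟩
  rw [Subtype.dist_eq, ← hD j, dist_comm] at hj
  rw [← dist_eq_norm]
  exact (ContinuousMap.dist_apply_le_dist (f := φ (D j)) (g := φ h) ⟨z, hz⟩).trans_lt hj

theorem ratDist_le_add (Φ : RatFunc ℂ) (z v w : ℂ) :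
    ratDist Φ z w ≤ ratDist Φ z v + ‖v - w‖ₑ := by
  rw [ratDist, ratDist]
  split_ifs
  · simp
  · simpa using enorm_add_le (Φ.eval (RingHom.id ℂ) z - v) (v - w)

theorem ratDist_le_padeError {F : ℂ → ℂ} {L S : Set ℂ} {p q : ℕ} {w : ℂ → ℂ} {ζ z : ℂ}
    (hζ : ζ ∈ L) (hz : z ∈ S) :
    ratDist (pade (taylorSeries F ζ) ζ p q) z (w z) ≤ padeError F L S p q w :=
  (le_iSup₂_of_le (f := fun z _ => ratDist (pade (taylorSeries F ζ) ζ p q) z (w z)) z hz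
    le_rfl).trans
    (le_iSup₂_of_le (f := fun ζ _ => ⨆ z ∈ S, ratDist (pade (taylorSeries F ζ) ζ p q) z (w z))
      ζ hζ le_rfl)

variable {Ω : Set ℂ}

/-- For ⊆, a single late term of the sequence meets each condition. For ⊇, the sequence is diagonal:
the index n sets the precision of the approximation to h, the compact set of centres and the
tolerance at once, so it is independent of L. -/
theorem universalSet_eq_iInter (𝔉 : Set (ℕ × ℕ)) (hΩo : IsOpen Ω) {K : ℕ → Set ℂ}
    (hK : ∀ m, IsCompact (K m) ∧ K m ⊆ Ωᶜ ∧ IsConnected (K m)ᶜ)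
    (hKcof : ∀ T : Set ℂ, IsCompact T → T ⊆ Ωᶜ → IsConnected Tᶜ → ∃ m, T ⊆ K m)
    {D : ℕ → ℕ → ℂ[X]} (hD : ∀ (m : ℕ) (h : ℂ[X]) {ε : ℝ}, 0 < ε →
      ∃ j, ∀ z ∈ K m, ‖(D m j).eval z - h.eval z‖ < ε) :
    universalSet 𝔉 Ω = ⋂ i : ℕ × ℕ × ℕ, goodSet 𝔉 Ω (K i.1)
      (innerCompact Ω i.2.2 (1 / (i.2.2 + 1))) (D i.1 i.2.1) (ENNReal.ofReal (1 / (i.2.2 + 1))) := by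
  ext f
  rw [Set.mem_iInter]
  constructor
  · rintro hf ⟨m, j, n⟩
    obtain ⟨p, q, hpq, h⟩ := hf (K m) (hK m).1 (hK m).2.1 (hK m).2.2 (D m j)
    obtain ⟨h1, h2, h3⟩ := h _ (isCompact_innerCompact Ω n (1 / (n + 1)))
      (innerCompact_subset (by positivity))
    have hε : 0 < ENNReal.ofReal (1 / ((n : ℝ) + 1)) := ENNReal.ofReal_pos.2 (by positivity)
    obtain ⟨k, k1, k2, k3⟩ :=
      (h1.and ((h2.eventually_lt_const hε).and (h3.eventually_lt_const hε))).exists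
    exact ⟨_, hpq k, fun ζ hζ => ⟨(k1 ζ hζ).1,
      fun z hz => (ratDist_le_padeError (w := fun z => (D m j).eval z) hζ hz).trans_lt k2,
      fun z hz => (ratDist_le_padeError hζ hz).trans_lt k3⟩⟩
  · intro hf T hT hTΩ hTc h
    obtain ⟨m, hTm⟩ := hKcof T hT hTΩ hTc
    choose j hj using fun n : ℕ => hD m h (ε := 1 / ((n : ℝ) + 1)) (by positivity)
    choose s hs hgood using fun n : ℕ => hf (m, j n, n)
    refine ⟨fun n => (s n).1, fun n => (s n).2, hs, fun L hL hLΩ => ?_⟩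
    obtain ⟨N, hN⟩ := exists_nat_forall_subset_innerCompact hΩo hL hLΩ
    have hlim : Tendsto (fun n : ℕ => ENNReal.ofReal (1 / ((n : ℝ) + 1))) atTop (𝓝 0) := by
      simpa using ENNReal.tendsto_ofReal (tendsto_one_div_add_atTop_nhds_zero_nat (𝕜 := ℝ))
    -- On K two errors of size 1/(n+1) add up: from the approximant to `D m (j n)`, and from there
    -- to h.
    have hlim' := hlim.add hlim
    rw [add_zero] at hlim'
    refine ⟨?_, ?_, ?_⟩
    · filter_upwards [eventually_ge_atTop N] with n hn ζ hζ
      have := (hgood n ζ (hN n hn hζ)).1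
      exact ⟨this, exists_isPade_of_inD this ζ⟩
    · refine tendsto_of_tendsto_of_tendsto_of_le_of_le' tendsto_const_nhds hlim'
        (Eventually.of_forall fun _ => zero_le) ?_
      filter_upwards [eventually_ge_atTop N] with n hn
      refine iSup₂_le fun ζ hζ => iSup₂_le fun z hz => ?_
      refine (ratDist_le_add _ z ((D m (j n)).eval z) _).trans (add_le_add ?_ ?_)
      · exact ((hgood n ζ (hN n hn hζ)).2.1 z (hTm hz)).le
      · rw [← ofReal_norm]
        exact ENNReal.ofReal_le_ofReal (hj n z (hTm hz)).le
    · refine tendsto_of_tendsto_of_tendsto_of_le_of_le' tendsto_const_nhds hlim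
        (Eventually.of_forall fun _ => zero_le) ?_
      filter_upwards [eventually_ge_atTop N] with n hn
      exact iSup₂_le fun ζ hζ => iSup₂_le fun z hz =>
        ((hgood n ζ (hN n hn hζ)).2.2 z (hN n hn hz)).le

end UniversalPade

end

/-! ### Conclusion by Baire's theorem -/

theorem theorem3p4 (𝔉 : Set (ℕ × ℕ))
    (h𝔉 : ∃ s : ℕ → ℕ × ℕ, (∀ n, s n ∈ 𝔉) ∧ Tendsto (fun n => (s n).1) atTop atTop)
    (Ω : Set ℂ) (hΩo : IsOpen Ω) (hΩc : IsSimplyConnected Ω) :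
    (UniversalPade.universalSet 𝔉 Ω).Nonempty ∧
      Dense (UniversalPade.universalSet 𝔉 Ω) ∧
      IsGδ (UniversalPade.universalSet 𝔉 Ω) := by
  obtain ⟨K, hK, hKcof⟩ := UniversalPade.exists_seq_compact_cofinal hΩo
    hΩc.isPathConnected.isConnected
  choose D hD using fun m => UniversalPade.exists_seq_polynomial_dense (hK m).1
  have heq := UniversalPade.universalSet_eq_iInter 𝔉 hΩo hK hKcof hD
  have hopen := fun i : ℕ × ℕ × ℕ => UniversalPade.isOpen_goodSet hΩo (𝔉 := 𝔉) (hK i.1).1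
    (UniversalPade.isCompact_innerCompact Ω i.2.2 (1 / (i.2.2 + 1)))
    (UniversalPade.innerCompact_subset (by positivity)) (D i.1 i.2.1)
    (ENNReal.ofReal (1 / (i.2.2 + 1)))
  have : BaireSpace (UniversalPade.Hol Ω) := UniversalPade.baireSpace_hol hΩo
  have : Nonempty (UniversalPade.Hol Ω) := ⟨UniversalPade.polyHol Ω 0⟩
  have hdense : Dense (UniversalPade.universalSet 𝔉 Ω) := by
    rw [heq]
    exact dense_iInter_of_isOpen hopen fun i => UniversalPade.dense_goodSet h𝔉 hΩo hΩc (hK i.1).1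
      (hK i.1).2.1 (hK i.1).2.2.isPreconnected (UniversalPade.innerCompact_subset (by positivity))
      _ (by positivity)
  refine ⟨hdense.nonempty, hdense, ?_⟩
  rw [heq]
  exact IsGδ.iInter_of_isOpen hopen
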